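/- **Proposition.** Composition is written in diagrammatic order: $f;g$ means first $f$, then $g$; and $\alpha\circ\beta$ denotes the horizontal composite of 2-cells in the same order, a 1-cell $f$ standing also for its identity 2-cell $\iota_f$. Let $\mathbf{sLin}$ be the category whose objects are the finite linear orders $n=\{0<\dots<n-1\}$, $n\in\mathbb N$, and whose morphisms are the surjective monotone maps. Every span in $\mathbf{sLin}$ is completed to a pushout square by exactly one cospan. Let $\mathbf{Cospan}(\mathbf{sLin})$ be the (strict) 2-category whose objects are those of $\mathbf{sLin}$, whose 1-cells $X\to Y$ are the cospans $X\xrightarrow{f_0}A\xleftarrow{f_1}Y$ in $\mathbf{sLin}$, composed by means of these unique pushouts, and whose 2-cells $(f_0,A,f_1)\Rightarrow(g_0,B,g_1)$ are the morphisms $\alpha:A\to B$ of $\mathbf{sLin}$ with $f_0;\alpha=g_0$ and $f_1;\alpha=g_1$. Ordinal sum $+$ of objects, of maps (hence of cospans and of 2-cells), with unit $0$, makes it a strict monoidal 2-category. Here a *strict monoidal 2-category* $(\mathcal D,\otimes,I)$ is a strict 2-category $\mathcal D$ with a 2-functor $\otimes:\mathcal D\times\mathcal D\to\mathcal D$ and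 an object $I$ such that $\otimes$ is associative and has unit $I$, strictly, on objects, 1-cells and 2-cells; a *strict monoidal 2-functor* is a (strict) 2-functor that preserves $I$ and $\otimes$ strictly, on objects, 1-cells and 2-cells. A *Como-algebra* $(D,\nabla,\Delta,\eta)$ in $(\mathcal D,\otimes,I)$ consists of an object $D$, 1-cells $\nabla:D\otimes D\to D$ and $\Delta:D\to D\otimes D$, and a 2-cell $\eta:\mathrm{id}_{D\otimes D}\Rightarrow\nabla;\Delta$ such that 1. $\nabla$ is associative and $\Delta$ is coassociative; 2. (separability) $\Delta;\nabla=\mathrm{id}_D$; 3. (Frobenius) $(\Delta\otimes\mathrm{id}_D);(\mathrm{id}_D\otimes\nabla)=\nabla;\Delta=(\mathrm{id}_D\otimes\Delta);(\nabla\otimes\mathrm{id}_D)$; 4. $\eta\circ\nabla=\iota_\nabla$ and $\Delta\circ\eta=\iota_\Delta$. In $\mathbf{Cospan}(\mathbf{sLin})$ the object $1$ carries the Como-algebra $(1,\nabla,\Delta,\eta)$ in which, with $\nabla:1+1\to1$ the unique map in $\mathbf{sLin}$, the 1-cell $\nabla$ is the cospan $(\nabla:1+1\to1\leftarrow1:\mathrm{id})$,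 the 1-cell $\Delta$ is the cospan $(\mathrm{id}:1\to1\leftarrow1+1:\nabla)$, and $\eta:\mathrm{id}_{1+1}\Rightarrow\nabla;\Delta$ is the 2-cell given by the map $\nabla:1+1\to1$ of $\mathbf{sLin}$. Let $(\mathcal D,\otimes,I)$ be a strict monoidal 2-category and $(D,\nabla,\Delta,\eta)$ a Como-algebra in it. Then there exists a unique strict monoidal 2-functor $$(\mathbf{Cospan}(\mathbf{sLin}),+,0)\longrightarrow(\mathcal D,\otimes,I)$$ mapping $(1,\nabla,\Delta,\eta)$ to $(D,\nabla,\Delta,\eta)$. -/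

import Mathlib

open CategoryTheory
open scoped Prod

universe w v u w' v' u'

-- Keeps the hom-quiver of a strict bicategory in its usual form `Bicategory.toCategoryStruct`.
attribute [-instance] catToReflQuiver

/-! ## The category of finite linear orders and monotone surjections -/

/-- An object `n = {0 < ... < n - 1}` of the category `sLin`, recorded by the natural number `n`. -/
structure SLin where
  card : ℕ

namespace SLin

/-- A morphism of `sLin`: a surjective monotone map. -/
@[ext]
structure Hom (X Y : SLin) where
  toFun : Fin X.card →o Fin Y.card
  surj : Function.Surjective toFun

instance : Category SLin where
  Hom := Hom
  id X := ⟨OrderHom.id, Function.surjective_id⟩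
  comp f g := ⟨g.toFun.comp f.toFun, g.surj.comp f.surj⟩

@[simp] theorem id_apply (X : SLin) (i : Fin X.card) : (𝟙 X : X ⟶ X).toFun i = i := rfl

@[simp] theorem comp_apply {X Y Z : SLin} (f : X ⟶ Y) (g : Y ⟶ Z) (i : Fin X.card) :
    (f ≫ g).toFun i = g.toFun (f.toFun i) := rfl

theorem hom_ext {X Y : SLin} {f g : X ⟶ Y} (h : ∀ i, f.toFun i = g.toFun i) : f = g :=
  Hom.ext (OrderHom.ext _ _ (funext h))

theorem congr_apply {X Y : SLin} {f g : X ⟶ Y} (h : f = g) (i : Fin X.card) :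
    f.toFun i = g.toFun i := by rw [h]

theorem hom_heq {X Y X' Y' : SLin} (hX : X = X') (hY : Y = Y') {f : X ⟶ Y} {g : X' ⟶ Y'}
    (h : ∀ i (h₁ : i < X.card) (h₂ : i < X'.card),
      (f.toFun ⟨i, h₁⟩).val = (g.toFun ⟨i, h₂⟩).val) : HEq f g := by
  subst hX hY
  exact heq_of_eq (hom_ext fun i => Fin.ext (h i.1 i.2 i.2))

instance {X Y : SLin} (f : X ⟶ Y) : Epi f where
  left_cancellation {Z} g h e := hom_ext fun i => by
    obtain ⟨j, rfl⟩ := f.surj i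
    exact congr_apply e j

theorem endo_eq_id {X : SLin} (f : X ⟶ X) : f = 𝟙 X := by
  have hs : StrictMono f.toFun :=
    f.toFun.monotone.strictMono_of_injective (Finite.injective_iff_surjective.2 f.surj)
  let e : Fin X.card ≃o Fin X.card := hs.orderIsoOfSurjective _ f.surj
  have he : e = OrderIso.refl _ := Subsingleton.elim _ _
  exact hom_ext fun i => congrArg (fun t : Fin X.card ≃o Fin X.card => t i) he

theorem eq_of_homs {X Y : SLin} (f : X ⟶ Y) (g : Y ⟶ X) : X = Y := by
  obtain ⟨m⟩ := X
  obtain ⟨n⟩ := Y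
  have h₁ := Fintype.card_le_of_surjective _ f.surj
  have h₂ := Fintype.card_le_of_surjective _ g.surj
  simp only [Fintype.card_fin] at h₁ h₂
  rw [le_antisymm h₂ h₁]

/-- A map that is constant on the fibres of a surjection factors through it. -/
theorem exists_factor {X Y Z : SLin} (h : X ⟶ Y) (k : X ⟶ Z)
    (H : ∀ i j, h.toFun i = h.toFun j → k.toFun i = k.toFun j) : ∃ t : Y ⟶ Z, h ≫ t = k := by
  have hs : ∀ y, h.toFun (Function.surjInv h.surj y) = y := Function.surjInv_eq h.surj
  refine ⟨⟨⟨fun y => k.toFun (Function.surjInv h.surj y), ?_⟩, ?_⟩, ?_⟩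
  · intro a b hab
    rcases hab.eq_or_lt with rfl | hlt
    · exact le_rfl
    · refine k.toFun.monotone (le_of_not_gt fun hgt => ?_)
      have := h.toFun.monotone hgt.le
      rw [hs, hs] at this
      exact absurd hlt (not_lt.2 this)
  · intro z
    obtain ⟨x, rfl⟩ := k.surj z
    exact ⟨h.toFun x, H _ _ (hs _)⟩
  · exact hom_ext fun i => H _ _ (hs _)

/-- The fibres of a monotone map are intervals, so constancy may be checked on neighbours. -/
theorem fibres_of_adjacent {X Y Z : SLin} (h : X ⟶ Y) (k : X ⟶ Z)
    (H : ∀ i (hi : i + 1 < X.card), h.toFun ⟨i, by lia⟩ = h.toFun ⟨i + 1, hi⟩ →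
      k.toFun ⟨i, by lia⟩ = k.toFun ⟨i + 1, hi⟩) :
    ∀ i j, h.toFun i = h.toFun j → k.toFun i = k.toFun j := by
  have key : ∀ d i (hi : i + d < X.card), h.toFun ⟨i, by lia⟩ = h.toFun ⟨i + d, hi⟩ →
      k.toFun ⟨i, by lia⟩ = k.toFun ⟨i + d, hi⟩ := by
    intro d
    induction d with
    | zero => intro i hi _; rfl
    | succ d ih =>
      intro i hi e
      have h₁ : h.toFun ⟨i, by lia⟩ ≤ h.toFun ⟨i + d, by lia⟩ :=
        h.toFun.monotone (Fin.mk_le_mk.2 (by lia))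
      have h₂ : h.toFun ⟨i + d, by lia⟩ ≤ h.toFun ⟨i + (d + 1), hi⟩ :=
        h.toFun.monotone (Fin.mk_le_mk.2 (by lia))
      have h₃ := le_antisymm h₁ (e ▸ h₂)
      exact (ih i (by lia) h₃).trans (H (i + d) hi (h₃.symm.trans e))
  rintro ⟨i, hi⟩ ⟨j, hj⟩ e
  rcases le_total i j with hij | hij
  · obtain ⟨d, rfl⟩ := Nat.exists_eq_add_of_le hij
    exact key d i hj e
  · obtain ⟨d, rfl⟩ := Nat.exists_eq_add_of_le hij
    exact (key d j hi e.symm).symm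

theorem isPushout_of_adjacent {K M N P : SLin} {f : K ⟶ M} {g : K ⟶ N} {a : M ⟶ P} {b : N ⟶ P}
    (w : f ≫ a = g ≫ b)
    (H : ∀ i (hi : i + 1 < K.card), (f ≫ a).toFun ⟨i, by lia⟩ = (f ≫ a).toFun ⟨i + 1, hi⟩ →
      f.toFun ⟨i, by lia⟩ = f.toFun ⟨i + 1, hi⟩ ∨ g.toFun ⟨i, by lia⟩ = g.toFun ⟨i + 1, hi⟩) :
    IsPushout f g a b := by
  have key : ∀ {R : SLin} (u : M ⟶ R) (v : N ⟶ R), f ≫ u = g ≫ v →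
      ∃ t : P ⟶ R, a ≫ t = u ∧ b ≫ t = v := by
    intro R u v e
    obtain ⟨t, ht⟩ := exists_factor (f ≫ a) (f ≫ u) (fibres_of_adjacent _ _ fun i hi h => by
      rcases H i hi h with h' | h'
      · simp [h']
      · rw [e]; simp [h'])
    refine ⟨t, ?_, ?_⟩
    · rwa [Category.assoc, cancel_epi] at ht
    · rwa [w, e, Category.assoc, cancel_epi] at ht
  refine ⟨⟨w⟩, ⟨Limits.PushoutCocone.IsColimit.mk w
    (fun s => (key s.inl s.inr s.condition).choose)
    (fun s => (key s.inl s.inr s.condition).choose_spec.1)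
    (fun s => (key s.inl s.inr s.condition).choose_spec.2)
    (fun s m hm _ => ?_)⟩⟩
  rw [← cancel_epi a, hm, (key s.inl s.inr s.condition).choose_spec.1]

open Classical in
/-- The number of positions below `i` at which neither `f` nor `g` identifies neighbours. -/
noncomputable def jumps {K M N : SLin} (f : K ⟶ M) (g : K ⟶ N) : ℕ → ℕ
  | 0 => 0
  | i + 1 => jumps f g i +
      if ∃ hi : i + 1 < K.card, f.toFun ⟨i, by lia⟩ = f.toFun ⟨i + 1, hi⟩ ∨
        g.toFun ⟨i, by lia⟩ = g.toFun ⟨i + 1, hi⟩ then 0 else 1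

theorem jumps_mono {K M N : SLin} (f : K ⟶ M) (g : K ⟶ N) : Monotone (jumps f g) :=
  monotone_nat_of_le_succ fun i => by rw [jumps]; lia

theorem exists_jumps_eq {K M N : SLin} (f : K ⟶ M) (g : K ⟶ N) (n c : ℕ)
    (hc : c ≤ jumps f g n) : ∃ i ≤ n, jumps f g i = c := by
  induction n with
  | zero => exact ⟨0, le_rfl, by rw [jumps] at hc ⊢; lia⟩
  | succ n ih =>
    by_cases h : c ≤ jumps f g n
    · obtain ⟨i, hi, e⟩ := ih h
      exact ⟨i, by lia, e⟩
    · refine ⟨n + 1, le_rfl, ?_⟩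
      rw [jumps] at hc ⊢
      split_ifs at hc ⊢ <;> lia

theorem exists_isPushout {K M N : SLin} (f : K ⟶ M) (g : K ⟶ N) :
    ∃ (P : SLin) (a : M ⟶ P) (b : N ⟶ P), IsPushout f g a b ∧ ∀ i (hi : i + 1 < K.card),
      (f ≫ a).toFun ⟨i, by lia⟩ = (f ≫ a).toFun ⟨i + 1, hi⟩ →
        f.toFun ⟨i, by lia⟩ = f.toFun ⟨i + 1, hi⟩ ∨
          g.toFun ⟨i, by lia⟩ = g.toFun ⟨i + 1, hi⟩ := by
  obtain ⟨Q, h, hh⟩ : ∃ (Q : SLin) (h : K ⟶ Q), ∀ i : Fin K.card,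
      (h.toFun i).val = jumps f g i.val := by
    obtain ⟨k⟩ := K
    cases k with
    | zero => exact ⟨⟨0⟩, 𝟙 _, fun i => i.elim0⟩
    | succ k =>
      refine ⟨⟨jumps f g k + 1⟩, ⟨⟨fun i => ⟨jumps f g i.val, ?_⟩, fun i j hij => ?_⟩, ?_⟩,
        fun i => rfl⟩
      · exact Nat.lt_succ_of_le (jumps_mono f g (Nat.le_of_lt_succ i.isLt))
      · exact Fin.mk_le_mk.2 (jumps_mono f g hij)
      · rintro ⟨c, hc⟩
        obtain ⟨i, hi, e⟩ := exists_jumps_eq f g k c (Nat.le_of_lt_succ hc)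
        exact ⟨⟨i, Nat.lt_succ_of_le hi⟩, Fin.ext e⟩
  have adj : ∀ i (hi : i + 1 < K.card), h.toFun ⟨i, by lia⟩ = h.toFun ⟨i + 1, hi⟩ ↔
      f.toFun ⟨i, by lia⟩ = f.toFun ⟨i + 1, hi⟩ ∨
        g.toFun ⟨i, by lia⟩ = g.toFun ⟨i + 1, hi⟩ := by
    intro i hi
    rw [Fin.ext_iff, hh, hh]
    simp only [jumps]
    split_ifs with H
    · exact ⟨fun _ => H.2, fun _ => rfl⟩
    · exact ⟨fun e => by lia, fun e => absurd ⟨hi, e⟩ H⟩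
  obtain ⟨a, ha⟩ := exists_factor f h (fibres_of_adjacent _ _ fun i hi e => (adj i hi).2 (.inl e))
  obtain ⟨b, hb⟩ := exists_factor g h (fibres_of_adjacent _ _ fun i hi e => (adj i hi).2 (.inr e))
  have H := fun i hi e => (adj i hi).1 (ha ▸ e)
  exact ⟨Q, a, b, isPushout_of_adjacent (ha.trans hb.symm) H, H⟩

/-- The category `sLin` has strict pushouts: each span is completed to a pushout square by
exactly one cospan. -/
theorem strict_pushouts {K M N : SLin} (f : K ⟶ M) (g : K ⟶ N) :
    ∃! s : Σ P : SLin, (M ⟶ P) × (N ⟶ P), IsPushout f g s.2.1 s.2.2 := by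
  obtain ⟨P, a, b, h, -⟩ := exists_isPushout f g
  refine ⟨⟨P, a, b⟩, h, ?_⟩
  rintro ⟨P', a', b'⟩ h'
  dsimp only at h'
  obtain rfl : P' = P := eq_of_homs (h'.desc a b h.w) (h.desc a' b' h'.w)
  have e := endo_eq_id (h'.desc a b h.w)
  have e₁ := h'.inl_desc a b h.w
  have e₂ := h'.inr_desc a b h.w
  rw [e, Category.comp_id] at e₁ e₂
  rw [e₁, e₂]

/-- The object of the strict pushout of `f` and `g`. -/
noncomputable def pushoutObj {K M N : SLin} (f : K ⟶ M) (g : K ⟶ N) : SLin :=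
  (strict_pushouts f g).choose.1

/-- The first leg of the strict pushout of `f` and `g`. -/
noncomputable def pushoutInl {K M N : SLin} (f : K ⟶ M) (g : K ⟶ N) : M ⟶ pushoutObj f g :=
  (strict_pushouts f g).choose.2.1

/-- The second leg of the strict pushout of `f` and `g`. -/
noncomputable def pushoutInr {K M N : SLin} (f : K ⟶ M) (g : K ⟶ N) : N ⟶ pushoutObj f g :=
  (strict_pushouts f g).choose.2.2

theorem isPushout {K M N : SLin} (f : K ⟶ M) (g : K ⟶ N) :
    IsPushout f g (pushoutInl f g) (pushoutInr f g) :=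
  (strict_pushouts f g).choose_spec.1

theorem pushout_unique {K M N : SLin} {f : K ⟶ M} {g : K ⟶ N} {P P' : SLin} {a : M ⟶ P}
    {b : N ⟶ P} {a' : M ⟶ P'} {b' : N ⟶ P'} (h : IsPushout f g a b) (h' : IsPushout f g a' b') :
    (⟨P, a, b⟩ : Σ P : SLin, (M ⟶ P) × (N ⟶ P)) = ⟨P', a', b'⟩ :=
  (strict_pushouts f g).unique (y₁ := ⟨P, a, b⟩) (y₂ := ⟨P', a', b'⟩) h h'

/-- In a pushout square, neighbours are identified only if one of the two maps identifies them. -/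
theorem adjacent_of_isPushout {K M N P : SLin} {f : K ⟶ M} {g : K ⟶ N} {a : M ⟶ P} {b : N ⟶ P}
    (h : IsPushout f g a b) (i : ℕ) (hi : i + 1 < K.card)
    (e : (f ≫ a).toFun ⟨i, by lia⟩ = (f ≫ a).toFun ⟨i + 1, hi⟩) :
    f.toFun ⟨i, by lia⟩ = f.toFun ⟨i + 1, hi⟩ ∨ g.toFun ⟨i, by lia⟩ = g.toFun ⟨i + 1, hi⟩ := by
  obtain ⟨P', a', b', h', H⟩ := exists_isPushout f g
  cases pushout_unique h h'
  exact H i hi e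

/-! ### Ordinal sum -/

/-- Ordinal sum of objects. -/
def sum (X Y : SLin) : SLin := ⟨X.card + Y.card⟩

/-- The map `Fin (m + n) → Fin (m' + n')` acting as `f` on the first summand and as `g` on the
second one. -/
def finSum {m n m' n' : ℕ} (f : Fin m → Fin m') (g : Fin n → Fin n') : Fin (m + n) → Fin (m' + n') :=
  Fin.addCases (fun i => Fin.castAdd n' (f i)) (fun j => Fin.natAdd m' (g j))

@[simp] theorem finSum_castAdd {m n m' n' : ℕ} (f : Fin m → Fin m') (g : Fin n → Fin n')
    (i : Fin m) : finSum f g (Fin.castAdd n i) = Fin.castAdd n' (f i) := by simp [finSum]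

@[simp] theorem finSum_natAdd {m n m' n' : ℕ} (f : Fin m → Fin m') (g : Fin n → Fin n')
    (j : Fin n) : finSum f g (Fin.natAdd m j) = Fin.natAdd m' (g j) := by simp [finSum]

theorem finSum_of_lt {m n m' n' : ℕ} (f : Fin m → Fin m') (g : Fin n → Fin n') (i : Fin (m + n))
    (hi : i.val < m) : (finSum f g i).val = (f ⟨i.val, hi⟩).val :=
  congrArg Fin.val (finSum_castAdd f g ⟨i.val, hi⟩)

theorem finSum_of_le {m n m' n' : ℕ} (f : Fin m → Fin m') (g : Fin n → Fin n') (i : Fin (m + n))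
    (hi : m ≤ i.val) : (finSum f g i).val = m' + (g ⟨i.val - m, by lia⟩).val := by
  have e : Fin.natAdd m (⟨i.val - m, by lia⟩ : Fin n) = i := Fin.ext (by simp; lia)
  rw [← Fin.val_natAdd, ← finSum_natAdd f g, e]

theorem finSum_monotone {m n m' n' : ℕ} {f : Fin m → Fin m'} {g : Fin n → Fin n'}
    (hf : Monotone f) (hg : Monotone g) : Monotone (finSum f g) := by
  intro i j hij
  rw [Fin.le_def] at hij ⊢
  rcases lt_or_ge j.val m with hj | hj
  · rw [finSum_of_lt f g i (by lia), finSum_of_lt f g j hj]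
    exact Fin.le_def.1 (hf (Fin.mk_le_mk.2 hij))
  · rw [finSum_of_le f g j hj]
    rcases lt_or_ge i.val m with hi | hi
    · rw [finSum_of_lt f g i hi]
      exact (f ⟨i.val, hi⟩).isLt.le.trans (Nat.le_add_right _ _)
    · rw [finSum_of_le f g i hi]
      exact Nat.add_le_add_left (Fin.le_def.1 (hg (Fin.mk_le_mk.2 (by lia)))) _

theorem finSum_surjective {m n m' n' : ℕ} {f : Fin m → Fin m'} {g : Fin n → Fin n'}
    (hf : Function.Surjective f) (hg : Function.Surjective g) :
    Function.Surjective (finSum f g) := by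
  intro i
  induction i using Fin.addCases with
  | left a =>
    obtain ⟨x, rfl⟩ := hf a
    exact ⟨Fin.castAdd _ x, by simp⟩
  | right b =>
    obtain ⟨y, rfl⟩ := hg b
    exact ⟨Fin.natAdd _ y, by simp⟩

/-- Ordinal sum of maps. -/
def sumMap {X Y X' Y' : SLin} (f : X ⟶ X') (g : Y ⟶ Y') : X.sum Y ⟶ X'.sum Y' where
  toFun := ⟨finSum f.toFun g.toFun, finSum_monotone f.toFun.monotone g.toFun.monotone⟩
  surj := finSum_surjective f.surj g.surj

theorem sumMap_of_lt {X Y X' Y' : SLin} (f : X ⟶ X') (g : Y ⟶ Y') (i : ℕ)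
    (h : i < (X.sum Y).card) (hi : i < X.card) :
    ((sumMap f g).toFun ⟨i, h⟩).val = (f.toFun ⟨i, hi⟩).val :=
  finSum_of_lt f.toFun g.toFun ⟨i, h⟩ hi

theorem sumMap_of_le {X Y X' Y' : SLin} (f : X ⟶ X') (g : Y ⟶ Y') (i : ℕ)
    (h : i < X.card + Y.card) (hi : X.card ≤ i) :
    ((sumMap f g).toFun ⟨i, h⟩).val = X'.card + (g.toFun ⟨i - X.card, by lia⟩).val :=
  finSum_of_le f.toFun g.toFun ⟨i, h⟩ hi

theorem sumMap_id (X Y : SLin) : sumMap (𝟙 X) (𝟙 Y) = 𝟙 (X.sum Y) := endo_eq_id _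

theorem sumMap_comp {X Y X' Y' X'' Y'' : SLin} (f : X ⟶ X') (g : Y ⟶ Y') (f' : X' ⟶ X'')
    (g' : Y' ⟶ Y'') : sumMap (f ≫ f') (g ≫ g') = sumMap f g ≫ sumMap f' g' := by
  refine hom_ext fun i => ?_
  change finSum _ _ i = finSum _ _ (finSum _ _ i)
  induction i using Fin.addCases <;> simp

theorem sum_assoc (X Y Z : SLin) : (X.sum Y).sum Z = X.sum (Y.sum Z) :=
  congrArg mk (Nat.add_assoc _ _ _)

theorem zero_sum (X : SLin) : (SLin.mk 0).sum X = X := congrArg mk (Nat.zero_add _)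

theorem sum_zero (X : SLin) : X.sum ⟨0⟩ = X := rfl

theorem sumMap_assoc {X Y Z X' Y' Z' : SLin} (f : X ⟶ X') (g : Y ⟶ Y') (h : Z ⟶ Z') :
    HEq (sumMap (sumMap f g) h) (sumMap f (sumMap g h)) := by
  refine hom_heq (sum_assoc _ _ _) (sum_assoc _ _ _) fun i h₁ h₂ => ?_
  rcases lt_or_ge i X.card with hi | hi
  · rw [sumMap_of_lt f _ _ _ hi, sumMap_of_lt (sumMap f g) h i h₁ (show i < (X.sum Y).card from Nat.lt_add_right _ hi),
      sumMap_of_lt f g _ _ hi]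
  · rw [sumMap_of_le f (sumMap g h) _ h₂ hi]
    rcases lt_or_ge i (X.card + Y.card) with hi' | hi'
    · rw [sumMap_of_lt (sumMap f g) h i h₁ hi', sumMap_of_le f g _ _ hi,
        sumMap_of_lt g h _ _ (by lia)]
    · rw [sumMap_of_le (sumMap f g) h _ h₁ hi',
        sumMap_of_le g h _ (by have : i < X.card + (Y.card + Z.card) := h₂; lia) (by lia)]
      change X'.card + Y'.card + _ = _
      simp only [Nat.add_assoc, Nat.sub_sub]
      rfl

theorem id_sumMap {X X' : SLin} (f : X ⟶ X') : HEq (sumMap (𝟙 (SLin.mk 0)) f) f :=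
  hom_heq (zero_sum _) (zero_sum _) fun i h₁ h₂ => by
    rw [sumMap_of_le _ f i h₁ (Nat.zero_le _)]
    simp

theorem sumMap_id_zero {X X' : SLin} (f : X ⟶ X') : HEq (sumMap f (𝟙 (SLin.mk 0))) f :=
  hom_heq (sum_zero _) (sum_zero _) fun i h₁ h₂ => by rw [sumMap_of_lt f _ i h₁ h₂]

/-- Pushouts interact with ordinal sum: the sum of two pushout squares is a pushout square. -/
theorem isPushout_sumMap {K M N P K' M' N' P' : SLin} {f : K ⟶ M} {g : K ⟶ N} {a : M ⟶ P}
    {b : N ⟶ P} {f' : K' ⟶ M'} {g' : K' ⟶ N'} {a' : M' ⟶ P'} {b' : N' ⟶ P'}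
    (h : IsPushout f g a b) (h' : IsPushout f' g' a' b') :
    IsPushout (sumMap f f') (sumMap g g') (sumMap a a') (sumMap b b') := by
  refine isPushout_of_adjacent (by rw [← sumMap_comp, ← sumMap_comp, h.w, h'.w])
    fun i hi e => ?_
  rw [← sumMap_comp] at e
  have hi₀ : i + 1 < K.card + K'.card := hi
  simp only [Fin.ext_iff] at e ⊢
  rcases lt_or_ge (i + 1) K.card with hK | hK
  · rw [sumMap_of_lt _ _ _ _ hK, sumMap_of_lt _ _ _ _ (Nat.lt_of_succ_lt hK)] at e
    rw [sumMap_of_lt _ _ _ _ hK, sumMap_of_lt _ _ _ _ (Nat.lt_of_succ_lt hK),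
      sumMap_of_lt _ _ _ _ hK, sumMap_of_lt _ _ _ _ (Nat.lt_of_succ_lt hK)]
    simpa only [Fin.ext_iff] using adjacent_of_isPushout h i hK (Fin.ext e)
  · rcases lt_or_ge i K.card with hK' | hK'
    · rw [sumMap_of_le _ _ _ hi₀ hK, sumMap_of_lt _ _ _ _ hK'] at e
      exact absurd e (((f ≫ a).toFun ⟨i, hK'⟩).isLt.trans_le (Nat.le_add_right _ _)).ne
    · obtain ⟨j, rfl⟩ := Nat.exists_eq_add_of_le hK'
      have hj : j + 1 < K'.card := by lia
      have e₁ : K.card + j - K.card = j := by lia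
      have e₂ : K.card + j + 1 - K.card = j + 1 := by lia
      rw [sumMap_of_le _ _ _ hi₀ hK, sumMap_of_le _ _ _ (by lia) hK'] at e
      rw [sumMap_of_le _ _ _ hi₀ hK, sumMap_of_le _ _ _ (by lia) hK',
        sumMap_of_le _ _ _ hi₀ hK, sumMap_of_le _ _ _ (by lia) hK']
      simp only [e₁, e₂, Nat.add_left_cancel_iff] at e ⊢
      simpa only [Fin.ext_iff] using adjacent_of_isPushout h' j hj (Fin.ext e)

/-- The map `∇ : 1 + 1 ⟶ 1`. -/
def nabla : (SLin.mk 1).sum ⟨1⟩ ⟶ SLin.mk 1 where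
  toFun := ⟨fun _ => 0, fun _ _ _ => le_rfl⟩
  surj _ := ⟨(0 : Fin 2), Subsingleton.elim _ _⟩

instance {X : SLin} : Subsingleton (X ⟶ SLin.mk 1) :=
  ⟨fun _ _ => hom_ext fun _ => Subsingleton.elim (α := Fin 1) _ _⟩

end SLin

/-! ## The 2-category of cospans in `sLin` -/

/-- An object of `Cospan(sLin)`: an object of `sLin`. -/
structure CospanSLin where
  ord : SLin

namespace CospanSLin

/-- A 1-cell of `Cospan(sLin)`: a cospan `X ⟶ apex ⟵ Y` in `sLin`. -/
structure Hom (X Y : CospanSLin) where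
  apex : SLin
  inl : X.ord ⟶ apex
  inr : Y.ord ⟶ apex

/-- A 2-cell of `Cospan(sLin)`: a morphism of `sLin` between the apexes commuting with the legs. -/
@[ext]
structure Hom₂ {X Y : CospanSLin} (f g : Hom X Y) where
  hom : f.apex ⟶ g.apex
  inl_hom : f.inl ≫ hom = g.inl
  inr_hom : f.inr ≫ hom = g.inr

instance (X Y : CospanSLin) : Category (Hom X Y) where
  Hom f g := Hom₂ f g
  id f := ⟨𝟙 f.apex, Category.comp_id _, Category.comp_id _⟩
  comp α β := ⟨α.hom ≫ β.hom, by rw [← Category.assoc, α.inl_hom, β.inl_hom],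
    by rw [← Category.assoc, α.inr_hom, β.inr_hom]⟩
  id_comp _ := Hom₂.ext (Category.id_comp _)
  comp_id _ := Hom₂.ext (Category.comp_id _)
  assoc _ _ _ := Hom₂.ext (Category.assoc _ _ _)

/-- Identities are identity cospans; the composite of two cospans is formed with the strict
pushout of the two inner legs. -/
noncomputable instance : CategoryStruct CospanSLin where
  Hom X Y := Hom X Y
  id X := ⟨X.ord, 𝟙 _, 𝟙 _⟩
  comp f g := ⟨SLin.pushoutObj f.inr g.inl, f.inl ≫ SLin.pushoutInl f.inr g.inl,
    g.inr ≫ SLin.pushoutInr f.inr g.inl⟩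

instance (X Y : CospanSLin) : Category (X ⟶ Y) := inferInstanceAs (Category (Hom X Y))

/-- There is at most one 2-cell between two cospans, as all maps of `sLin` are epimorphisms. -/
instance {X Y : CospanSLin} (f g : X ⟶ Y) : Subsingleton (f ⟶ g) where
  allEq α β := Hom₂.ext (by rw [← cancel_epi f.inl]; exact α.inl_hom.trans β.inl_hom.symm)

theorem comp_eq {X Y Z : CospanSLin} (f : X ⟶ Y) (g : Y ⟶ Z) {P : SLin} {a : f.apex ⟶ P}
    {b : g.apex ⟶ P} (h : IsPushout f.inr g.inl a b) :
    f ≫ g = (⟨P, f.inl ≫ a, g.inr ≫ b⟩ : Hom X Z) :=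
  congrArg (fun s : Σ P : SLin, (f.apex ⟶ P) × (g.apex ⟶ P) =>
    (⟨s.1, f.inl ≫ s.2.1, g.inr ≫ s.2.2⟩ : Hom X Z))
    (SLin.pushout_unique (SLin.isPushout f.inr g.inl) h)

theorem id_comp' {X Y : CospanSLin} (f : X ⟶ Y) : 𝟙 X ≫ f = f := by
  rw [comp_eq (𝟙 X) f (a := f.inl) (b := 𝟙 _) IsPushout.of_id_fst]
  change (⟨f.apex, 𝟙 _ ≫ f.inl, f.inr ≫ 𝟙 _⟩ : Hom X Y) = f
  rw [Category.id_comp, Category.comp_id]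
  rfl

theorem comp_id' {X Y : CospanSLin} (f : X ⟶ Y) : f ≫ 𝟙 Y = f := by
  rw [comp_eq f (𝟙 Y) (a := 𝟙 _) (b := f.inr) IsPushout.of_id_snd]
  change (⟨f.apex, f.inl ≫ 𝟙 _, 𝟙 _ ≫ f.inr⟩ : Hom X Y) = f
  rw [Category.id_comp, Category.comp_id]
  rfl

theorem assoc' {W X Y Z : CospanSLin} (f : W ⟶ X) (g : X ⟶ Y) (h : Y ⟶ Z) :
    (f ≫ g) ≫ h = f ≫ g ≫ h := by
  have hP := SLin.isPushout f.inr g.inl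
  have hQ := SLin.isPushout g.inr h.inl
  have hR := SLin.isPushout (SLin.pushoutInr f.inr g.inl) (SLin.pushoutInl g.inr h.inl)
  rw [comp_eq (f ≫ g) h (hQ.paste_horiz hR), comp_eq f (g ≫ h) (hP.paste_vert hR)]
  change (⟨_, (f.inl ≫ _) ≫ _, _⟩ : Hom W Z) = ⟨_, _, (h.inr ≫ _) ≫ _⟩
  rw [Category.assoc, Category.assoc]

/-- Left whiskering: the map of pushouts induced by `θ` and the identity of `f`. -/
noncomputable def whiskerLeft {X Y Z : CospanSLin} (f : X ⟶ Y) {g g' : Y ⟶ Z} (θ : g ⟶ g') :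
    f ≫ g ⟶ f ≫ g' where
  hom := (SLin.isPushout f.inr g.inl).desc (SLin.pushoutInl f.inr g'.inl)
    (θ.hom ≫ SLin.pushoutInr f.inr g'.inl)
    (by rw [← Category.assoc, θ.inl_hom]; exact (SLin.isPushout f.inr g'.inl).w)
  inl_hom := by
    change (f.inl ≫ SLin.pushoutInl f.inr g.inl) ≫ _ = f.inl ≫ SLin.pushoutInl f.inr g'.inl
    rw [Category.assoc, IsPushout.inl_desc]
  inr_hom := by
    change (g.inr ≫ SLin.pushoutInr f.inr g.inl) ≫ _ = g'.inr ≫ SLin.pushoutInr f.inr g'.inl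
    rw [Category.assoc, IsPushout.inr_desc, ← Category.assoc, θ.inr_hom]

/-- Right whiskering: the map of pushouts induced by `θ` and the identity of `g`. -/
noncomputable def whiskerRight {X Y Z : CospanSLin} {f f' : X ⟶ Y} (θ : f ⟶ f') (g : Y ⟶ Z) :
    f ≫ g ⟶ f' ≫ g where
  hom := (SLin.isPushout f.inr g.inl).desc (θ.hom ≫ SLin.pushoutInl f'.inr g.inl)
    (SLin.pushoutInr f'.inr g.inl)
    (by rw [← Category.assoc, θ.inr_hom]; exact (SLin.isPushout f'.inr g.inl).w)
  inl_hom := by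
    change (f.inl ≫ SLin.pushoutInl f.inr g.inl) ≫ _ = f'.inl ≫ SLin.pushoutInl f'.inr g.inl
    rw [Category.assoc, IsPushout.inl_desc, ← Category.assoc, θ.inl_hom]
  inr_hom := by
    change (g.inr ≫ SLin.pushoutInr f.inr g.inl) ≫ _ = g.inr ≫ SLin.pushoutInr f'.inr g.inl
    rw [Category.assoc, IsPushout.inr_desc]

noncomputable instance : Bicategory CospanSLin where
  whiskerLeft f _ _ θ := whiskerLeft f θ
  whiskerRight θ g := whiskerRight θ g
  associator f g h := eqToIso (assoc' f g h)
  leftUnitor f := eqToIso (id_comp' f)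
  rightUnitor f := eqToIso (comp_id' f)
  whiskerLeft_id _ _ := Subsingleton.elim _ _
  whiskerLeft_comp _ _ _ _ _ _ := Subsingleton.elim _ _
  id_whiskerLeft _ := Subsingleton.elim _ _
  comp_whiskerLeft _ _ _ _ _ := Subsingleton.elim _ _
  id_whiskerRight _ _ := Subsingleton.elim _ _
  comp_whiskerRight _ _ _ := Subsingleton.elim _ _
  whiskerRight_id _ := Subsingleton.elim _ _
  whiskerRight_comp _ _ _ := Subsingleton.elim _ _
  whisker_assoc _ _ _ _ _ := Subsingleton.elim _ _
  whisker_exchange _ _ := Subsingleton.elim _ _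
  pentagon _ _ _ _ := Subsingleton.elim _ _
  triangle _ _ := Subsingleton.elim _ _

instance : Bicategory.Strict CospanSLin where
  id_comp := id_comp'
  comp_id := comp_id'
  assoc := assoc'
  leftUnitor_eqToIso _ := rfl
  rightUnitor_eqToIso _ := rfl
  associator_eqToIso _ _ _ := rfl

end CospanSLin

/-! ## Strict monoidal 2-categories, strict monoidal 2-functors and Como-algebras -/

section Binary

variable {B : Type u} [Bicategory.{w, v} B] (T : StrictPseudofunctor (B × B) B)

/-- The value of a 2-functor `T : B × B → B` on a pair of objects. -/
abbrev binObj (X Y : B) : B := T.obj (X, Y)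

/-- The value of a 2-functor `T : B × B → B` on a pair of 1-cells. -/
abbrev binMap {X Y X' Y' : B} (f : X ⟶ X') (g : Y ⟶ Y') : binObj T X Y ⟶ binObj T X' Y' :=
  T.map (f ×ₘ g)

/-- The value of a 2-functor `T : B × B → B` on a pair of 2-cells. -/
abbrev binMap₂ {X Y X' Y' : B} {f f' : X ⟶ X'} {g g' : Y ⟶ Y'} (α : f ⟶ f') (β : g ⟶ g') :
    binMap T f g ⟶ binMap T f' g' :=
  T.map₂ (f := (f ×ₘ g)) (g := (f' ×ₘ g')) (α ×ₘ β)

end Binary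

/-- A strict monoidal structure on a strict 2-category `B`: a 2-functor `B × B → B` and an object
`I` of `B` such that the tensor is strictly associative and strictly unital on objects, 1-cells and
2-cells. -/
class StrictMonoidalTwoCategory (B : Type u) [Bicategory.{w, v} B] [Bicategory.Strict B] where
  tensor : StrictPseudofunctor (B × B) B
  unit : B
  assoc_obj (X Y Z : B) :
    binObj tensor (binObj tensor X Y) Z = binObj tensor X (binObj tensor Y Z)
  assoc_map {X Y Z X' Y' Z' : B} (f : X ⟶ X') (g : Y ⟶ Y') (h : Z ⟶ Z') :
    HEq (binMap tensor (binMap tensor f g) h) (binMap tensor f (binMap tensor g h))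
  assoc_map₂ {X Y Z X' Y' Z' : B} {f f' : X ⟶ X'} {g g' : Y ⟶ Y'} {h h' : Z ⟶ Z'}
    (α : f ⟶ f') (β : g ⟶ g') (γ : h ⟶ h') :
    HEq (binMap₂ tensor (binMap₂ tensor α β) γ) (binMap₂ tensor α (binMap₂ tensor β γ))
  unit_tensor_obj (X : B) : binObj tensor unit X = X
  unit_tensor_map {X X' : B} (f : X ⟶ X') : HEq (binMap tensor (𝟙 unit) f) f
  unit_tensor_map₂ {X X' : B} {f f' : X ⟶ X'} (α : f ⟶ f') :
    HEq (binMap₂ tensor (𝟙 (𝟙 unit)) α) α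
  tensor_unit_obj (X : B) : binObj tensor X unit = X
  tensor_unit_map {X X' : B} (f : X ⟶ X') : HEq (binMap tensor f (𝟙 unit)) f
  tensor_unit_map₂ {X X' : B} {f f' : X ⟶ X'} (α : f ⟶ f') :
    HEq (binMap₂ tensor α (𝟙 (𝟙 unit))) α

namespace StrictMonoidalTwoCategory

variable {B : Type u} [Bicategory.{w, v} B] [Bicategory.Strict B] [StrictMonoidalTwoCategory B]

/-- The tensor product of objects. -/
abbrev tensorObj (X Y : B) : B := binObj tensor X Y

/-- The tensor product of 1-cells. -/
abbrev tensorHom {X Y X' Y' : B} (f : X ⟶ X') (g : Y ⟶ Y') : tensorObj X Y ⟶ tensorObj X' Y' :=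
  binMap tensor f g

/-- The tensor product of 2-cells. -/
abbrev tensorHom₂ {X Y X' Y' : B} {f f' : X ⟶ X'} {g g' : Y ⟶ Y'} (α : f ⟶ f') (β : g ⟶ g') :
    tensorHom f g ⟶ tensorHom f' g' :=
  binMap₂ tensor α β

/-- The identity `(X ⊗ Y) ⊗ Z = X ⊗ (Y ⊗ Z)`, as a 1-cell. -/
abbrev assocHom (X Y Z : B) : tensorObj (tensorObj X Y) Z ⟶ tensorObj X (tensorObj Y Z) :=
  eqToHom (assoc_obj X Y Z)

/-- The identity `X ⊗ (Y ⊗ Z) = (X ⊗ Y) ⊗ Z`, as a 1-cell. -/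
abbrev assocInv (X Y Z : B) : tensorObj X (tensorObj Y Z) ⟶ tensorObj (tensorObj X Y) Z :=
  eqToHom (assoc_obj X Y Z).symm

end StrictMonoidalTwoCategory

open StrictMonoidalTwoCategory

/-- A strict monoidal 2-functor: a 2-functor that preserves the unit object and the tensor of
objects, 1-cells and 2-cells strictly. -/
structure StrictMonoidalTwoFunctor (B : Type u) [Bicategory.{w, v} B] [Bicategory.Strict B]
    [StrictMonoidalTwoCategory B] (C : Type u') [Bicategory.{w', v'} C] [Bicategory.Strict C]
    [StrictMonoidalTwoCategory C] extends StrictPseudofunctor B C where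
  obj_unit : obj (unit (B := B)) = unit (B := C)
  obj_tensor (X Y : B) : obj (tensorObj X Y) = tensorObj (obj X) (obj Y)
  map_tensor {X Y X' Y' : B} (f : X ⟶ X') (g : Y ⟶ Y') :
    HEq (map (tensorHom f g)) (tensorHom (map f) (map g))
  map₂_tensor {X Y X' Y' : B} {f f' : X ⟶ X'} {g g' : Y ⟶ Y'} (α : f ⟶ f') (β : g ⟶ g') :
    HEq (map₂ (tensorHom₂ α β)) (tensorHom₂ (map₂ α) (map₂ β))

open scoped Bicategory in
/-- A Como-algebra `(D, ∇, Δ, η)`: a separable semialgebra `(D, ∇, Δ)` together with a 2-cell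
`η : id ⟶ ∇ ; Δ` that exhibits `∇` as left adjoint to `Δ` with identity counit. -/
structure ComoAlgebra (B : Type u) [Bicategory.{w, v} B] [Bicategory.Strict B]
    [StrictMonoidalTwoCategory B] where
  carrier : B
  mul : tensorObj carrier carrier ⟶ carrier
  comul : carrier ⟶ tensorObj carrier carrier
  assoc : tensorHom mul (𝟙 carrier) ≫ mul =
    assocHom carrier carrier carrier ≫ tensorHom (𝟙 carrier) mul ≫ mul
  coassoc : comul ≫ tensorHom comul (𝟙 carrier) ≫ assocHom carrier carrier carrier =
    comul ≫ tensorHom (𝟙 carrier) comul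
  separable : comul ≫ mul = 𝟙 carrier
  frobenius_left : tensorHom comul (𝟙 carrier) ≫ assocHom carrier carrier carrier ≫
    tensorHom (𝟙 carrier) mul = mul ≫ comul
  frobenius_right : tensorHom (𝟙 carrier) comul ≫ assocInv carrier carrier carrier ≫
    tensorHom mul (𝟙 carrier) = mul ≫ comul
  unit : 𝟙 (tensorObj carrier carrier) ⟶ mul ≫ comul
  unit_mul : unit ▷ mul = eqToHom (by
    rw [Bicategory.Strict.id_comp, Bicategory.Strict.assoc, separable, Bicategory.Strict.comp_id])
  comul_unit : comul ◁ unit = eqToHom (by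
    rw [Bicategory.Strict.comp_id, ← Bicategory.Strict.assoc, separable,
      Bicategory.Strict.id_comp])

/-- The 2-functor `F` maps the Como-algebra `A` to the Como-algebra `A'`. -/
structure StrictMonoidalTwoFunctor.MapsTo {B : Type u} [Bicategory.{w, v} B] [Bicategory.Strict B]
    [StrictMonoidalTwoCategory B] {C : Type u'} [Bicategory.{w', v'} C] [Bicategory.Strict C]
    [StrictMonoidalTwoCategory C] (F : StrictMonoidalTwoFunctor B C) (A : ComoAlgebra B)
    (A' : ComoAlgebra C) : Prop where
  carrier : F.obj A.carrier = A'.carrier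
  mul : HEq (F.map A.mul) A'.mul
  comul : HEq (F.map A.comul) A'.comul
  unit : HEq (F.map₂ A.unit) A'.unit

/-! ## The monoidal structure of `Cospan(sLin)` and its Como-algebra -/

namespace CospanSLin

/-- The sum of two objects. -/
def sum (X Y : CospanSLin) : CospanSLin := ⟨X.ord.sum Y.ord⟩

/-- The sum of two cospans. -/
def sumHom {X Y X' Y' : CospanSLin} (f : X ⟶ X') (g : Y ⟶ Y') : X.sum Y ⟶ X'.sum Y' :=
  (⟨f.apex.sum g.apex, SLin.sumMap f.inl g.inl, SLin.sumMap f.inr g.inr⟩ :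
    Hom (X.sum Y) (X'.sum Y'))

/-- The sum of two 2-cells. -/
def sumHom₂ {X Y X' Y' : CospanSLin} {f f' : X ⟶ X'} {g g' : Y ⟶ Y'} (α : f ⟶ f') (β : g ⟶ g') :
    sumHom f g ⟶ sumHom f' g' where
  hom := SLin.sumMap α.hom β.hom
  inl_hom := (SLin.sumMap_comp _ _ _ _).symm.trans (congrArg₂ _ α.inl_hom β.inl_hom)
  inr_hom := (SLin.sumMap_comp _ _ _ _).symm.trans (congrArg₂ _ α.inr_hom β.inr_hom)

theorem sumHom_id (X Y : CospanSLin) : sumHom (𝟙 X) (𝟙 Y) = 𝟙 (X.sum Y) := by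
  change (⟨_, SLin.sumMap (𝟙 _) (𝟙 _), SLin.sumMap (𝟙 _) (𝟙 _)⟩ : Hom (X.sum Y) (X.sum Y)) = _
  rw [SLin.sumMap_id]
  rfl

theorem sumHom_comp {X Y X' Y' X'' Y'' : CospanSLin} (f : X ⟶ X') (g : Y ⟶ Y') (f' : X' ⟶ X'')
    (g' : Y' ⟶ Y'') : sumHom (f ≫ f') (g ≫ g') = sumHom f g ≫ sumHom f' g' := by
  rw [comp_eq (sumHom f g) (sumHom f' g')
    (SLin.isPushout_sumMap (SLin.isPushout f.inr f'.inl) (SLin.isPushout g.inr g'.inl))]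
  change (⟨_, SLin.sumMap (_ ≫ _) (_ ≫ _), SLin.sumMap (_ ≫ _) (_ ≫ _)⟩ :
    Hom (X.sum Y) (X''.sum Y'')) = _
  rw [SLin.sumMap_comp, SLin.sumMap_comp]
  rfl

/-- The sum as a 2-functor. -/
noncomputable def sumFunctor : StrictPseudofunctor (CospanSLin × CospanSLin) CospanSLin :=
  StrictPseudofunctor.mk''
    { obj := fun X => X.1.sum X.2
      map := fun f => sumHom f.1 f.2
      map₂ := fun α => sumHom₂ α.1 α.2
      map₂_id := fun _ => Subsingleton.elim _ _
      map₂_comp := fun _ _ => Subsingleton.elim _ _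
      map_id := fun X => sumHom_id X.1 X.2
      map_comp := fun f g => sumHom_comp f.1 f.2 g.1 g.2
      map₂_whisker_left := fun _ _ _ _ => Subsingleton.elim _ _
      map₂_whisker_right := fun _ _ => Subsingleton.elim _ _ }

theorem hom_heq {X Y X' Y' : CospanSLin} (hX : X = X') (hY : Y = Y') {f : X ⟶ Y} {g : X' ⟶ Y'}
    (ha : f.apex = g.apex) (hl : HEq f.inl g.inl) (hr : HEq f.inr g.inr) : HEq f g := by
  subst hX hY
  obtain ⟨a, l, r⟩ := f
  obtain ⟨a', l', r'⟩ := g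
  obtain rfl : a = a' := ha
  obtain rfl : l = l' := eq_of_heq hl
  obtain rfl : r = r' := eq_of_heq hr
  rfl

theorem hom₂_heq {X Y X' Y' : CospanSLin} (hX : X = X') (hY : Y = Y') {f₁ f₂ : X ⟶ Y}
    {g₁ g₂ : X' ⟶ Y'} (h₁ : HEq f₁ g₁) (h₂ : HEq f₂ g₂) (α : f₁ ⟶ f₂) (β : g₁ ⟶ g₂) :
    HEq α β := by
  subst hX hY
  obtain rfl := eq_of_heq h₁
  obtain rfl := eq_of_heq h₂
  exact heq_of_eq (Subsingleton.elim _ _)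

theorem sum_assoc (X Y Z : CospanSLin) : (X.sum Y).sum Z = X.sum (Y.sum Z) :=
  congrArg mk (SLin.sum_assoc _ _ _)

theorem zero_sum (X : CospanSLin) : (CospanSLin.mk ⟨0⟩).sum X = X := congrArg mk (SLin.zero_sum _)

theorem sum_zero (X : CospanSLin) : X.sum ⟨⟨0⟩⟩ = X := rfl

theorem sumHom_assoc {X Y Z X' Y' Z' : CospanSLin} (f : X ⟶ X') (g : Y ⟶ Y') (h : Z ⟶ Z') :
    HEq (sumHom (sumHom f g) h) (sumHom f (sumHom g h)) :=
  hom_heq (sum_assoc _ _ _) (sum_assoc _ _ _) (SLin.sum_assoc _ _ _)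
    (SLin.sumMap_assoc _ _ _) (SLin.sumMap_assoc _ _ _)

theorem id_sumHom {X X' : CospanSLin} (f : X ⟶ X') : HEq (sumHom (𝟙 (CospanSLin.mk ⟨0⟩)) f) f :=
  hom_heq (zero_sum _) (zero_sum _) (SLin.zero_sum _) (SLin.id_sumMap _) (SLin.id_sumMap _)

theorem sumHom_id_zero {X X' : CospanSLin} (f : X ⟶ X') :
    HEq (sumHom f (𝟙 (CospanSLin.mk ⟨0⟩))) f :=
  hom_heq (sum_zero _) (sum_zero _) (SLin.sum_zero _) (SLin.sumMap_id_zero _)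
    (SLin.sumMap_id_zero _)

noncomputable instance : StrictMonoidalTwoCategory CospanSLin where
  tensor := sumFunctor
  unit := ⟨⟨0⟩⟩
  assoc_obj := sum_assoc
  assoc_map := sumHom_assoc
  assoc_map₂ _ _ _ := hom₂_heq (sum_assoc _ _ _) (sum_assoc _ _ _) (sumHom_assoc _ _ _)
    (sumHom_assoc _ _ _) _ _
  unit_tensor_obj := zero_sum
  unit_tensor_map := id_sumHom
  unit_tensor_map₂ _ := hom₂_heq (zero_sum _) (zero_sum _) (id_sumHom _) (id_sumHom _) _ _
  tensor_unit_obj := sum_zero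
  tensor_unit_map := sumHom_id_zero
  tensor_unit_map₂ _ := hom₂_heq (sum_zero _) (sum_zero _) (sumHom_id_zero _) (sumHom_id_zero _) _ _

/-- The cospan `X ⟶ Y ⟵ Y : id` of a map `X ⟶ Y`. -/
def forward {X Y : SLin} (f : X ⟶ Y) : CospanSLin.mk X ⟶ CospanSLin.mk Y :=
  (⟨Y, f, 𝟙 Y⟩ : Hom (CospanSLin.mk X) (CospanSLin.mk Y))

/-- The cospan `id : Y ⟶ Y ⟵ X` of a map `X ⟶ Y`. -/
def backward {X Y : SLin} (f : X ⟶ Y) : CospanSLin.mk Y ⟶ CospanSLin.mk X :=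
  (⟨Y, 𝟙 Y, f⟩ : Hom (CospanSLin.mk Y) (CospanSLin.mk X))

/-- The 2-cell from the identity cospan of `X` to `X ⟶ Y ⟵ X` given by a map `f : X ⟶ Y`. -/
noncomputable def bar {X Y : SLin} (f : X ⟶ Y) :
    𝟙 (CospanSLin.mk X) ⟶ forward f ≫ backward f where
  hom := f ≫ SLin.pushoutInl (𝟙 Y) (𝟙 Y)
  inl_hom := Category.id_comp _
  inr_hom := by
    have h := (SLin.isPushout (𝟙 Y) (𝟙 Y)).w
    rw [Category.id_comp, Category.id_comp] at h
    rw [h]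
    exact Category.id_comp _

theorem forward_comp_backward {X Y Z : SLin} (f : X ⟶ Y) (g : Z ⟶ Y) :
    forward f ≫ backward g = (⟨Y, f, g⟩ : Hom ⟨X⟩ ⟨Z⟩) := by
  rw [comp_eq (forward f) (backward g) (a := 𝟙 Y) (b := 𝟙 Y) IsPushout.of_id_fst]
  change (⟨Y, f ≫ 𝟙 _, g ≫ 𝟙 _⟩ : Hom ⟨X⟩ ⟨Z⟩) = _
  rw [Category.comp_id, Category.comp_id]

theorem forward_comp {X Y Z : SLin} (f : X ⟶ Y) (g : Y ⟶ Z) :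
    forward f ≫ forward g = forward (f ≫ g) := by
  rw [comp_eq (forward f) (forward g) (a := g) (b := 𝟙 Z) IsPushout.of_id_fst]
  rfl

theorem backward_comp {X Y Z : SLin} (f : X ⟶ Y) (g : Y ⟶ Z) :
    backward g ≫ backward f = backward (f ≫ g) := by
  rw [comp_eq (backward g) (backward f) (a := 𝟙 Z) (b := g) IsPushout.of_id_snd]
  rfl

theorem backward_comp_forward {X Y Z P : SLin} {f : X ⟶ Y} {g : X ⟶ Z} {a : Y ⟶ P} {b : Z ⟶ P}
    (h : IsPushout f g a b) : backward f ≫ forward g = (⟨P, a, b⟩ : Hom ⟨Y⟩ ⟨Z⟩) := by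
  rw [comp_eq (backward f) (forward g) h]
  change (⟨P, 𝟙 _ ≫ a, 𝟙 _ ≫ b⟩ : Hom ⟨Y⟩ ⟨Z⟩) = _
  rw [Category.id_comp, Category.id_comp]

theorem sumHom_forward {X Y X' Y' : SLin} (f : X ⟶ X') (g : Y ⟶ Y') :
    sumHom (forward f) (forward g) = forward (SLin.sumMap f g) := by
  change (⟨_, _, SLin.sumMap (𝟙 _) (𝟙 _)⟩ : Hom _ _) = _
  rw [SLin.sumMap_id]
  rfl

theorem sumHom_backward {X Y X' Y' : SLin} (f : X ⟶ X') (g : Y ⟶ Y') :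
    sumHom (backward f) (backward g) = backward (SLin.sumMap f g) := by
  change (⟨_, SLin.sumMap (𝟙 _) (𝟙 _), _⟩ : Hom _ _) = _
  rw [SLin.sumMap_id]
  rfl

theorem isPushout_of_zero_one {f g : SLin.mk 3 ⟶ SLin.mk 2}
    (hf : f.toFun (0 : Fin 3) = f.toFun (1 : Fin 3))
    (hg : g.toFun (1 : Fin 3) = g.toFun (2 : Fin 3)) (a b : SLin.mk 2 ⟶ SLin.mk 1) :
    IsPushout f g a b :=
  SLin.isPushout_of_adjacent (Subsingleton.elim _ _) fun i hi _ => by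
    have : i < 2 := Nat.lt_of_succ_lt_succ hi
    interval_cases i
    · exact .inl hf
    · exact .inr hg

/-- The Como-algebra `(1, ∇, Δ, η)` in `Cospan(sLin)`: here `∇` is the cospan
`∇ : 1 + 1 ⟶ 1 ⟵ 1 : id`, `Δ` is the cospan `id : 1 ⟶ 1 ⟵ 1 + 1 : ∇`, and `η` is the 2-cell from the
identity cospan of `1 + 1` to `∇ ; Δ` given by the map `∇`. -/
noncomputable def como : ComoAlgebra CospanSLin where
  carrier := ⟨⟨1⟩⟩
  mul := forward SLin.nabla
  comul := backward SLin.nabla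
  assoc := by
    have h : sumHom (forward SLin.nabla) (forward (𝟙 (SLin.mk 1))) ≫ forward SLin.nabla =
        𝟙 (CospanSLin.mk ⟨3⟩) ≫
          (sumHom (forward (𝟙 (SLin.mk 1))) (forward SLin.nabla) ≫ forward SLin.nabla) := by
      rw [Bicategory.Strict.id_comp, sumHom_forward, sumHom_forward]
      refine (forward_comp _ _).trans (Eq.trans ?_ (forward_comp _ _).symm)
      exact congrArg forward (Subsingleton.elim _ _)
    exact h
  coassoc := by
    have h : backward SLin.nabla ≫ sumHom (backward SLin.nabla) (backward (𝟙 (SLin.mk 1))) ≫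
        𝟙 (CospanSLin.mk ⟨3⟩) =
          backward SLin.nabla ≫ sumHom (backward (𝟙 (SLin.mk 1))) (backward SLin.nabla) := by
      rw [sumHom_backward, sumHom_backward]
      refine (congrArg (backward SLin.nabla ≫ ·) (Bicategory.Strict.comp_id _)).trans ?_
      refine (backward_comp _ _).trans (Eq.trans ?_ (backward_comp _ _).symm)
      exact congrArg backward (Subsingleton.elim _ _)
    exact h
  separable := by
    have h : backward SLin.nabla ≫ forward SLin.nabla = 𝟙 (CospanSLin.mk ⟨1⟩) := by
      rw [backward_comp_forward (a := 𝟙 _) (b := 𝟙 _)]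
      · rfl
      · exact SLin.isPushout_of_adjacent rfl fun _ _ _ => .inl rfl
    exact h
  frobenius_left := by
    have h : sumHom (backward SLin.nabla) (backward (𝟙 (SLin.mk 1))) ≫ 𝟙 (CospanSLin.mk ⟨3⟩) ≫
        sumHom (forward (𝟙 (SLin.mk 1))) (forward SLin.nabla) =
          forward SLin.nabla ≫ backward SLin.nabla := by
      rw [sumHom_backward, sumHom_forward, forward_comp_backward]
      refine (congrArg (backward _ ≫ ·) (Bicategory.Strict.id_comp _)).trans ?_
      exact backward_comp_forward (isPushout_of_zero_one rfl rfl _ _)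
    exact h
  frobenius_right := by
    have h : sumHom (backward (𝟙 (SLin.mk 1))) (backward SLin.nabla) ≫ 𝟙 (CospanSLin.mk ⟨3⟩) ≫
        sumHom (forward SLin.nabla) (forward (𝟙 (SLin.mk 1))) =
          forward SLin.nabla ≫ backward SLin.nabla := by
      rw [sumHom_backward, sumHom_forward, forward_comp_backward]
      refine (congrArg (backward _ ≫ ·) (Bicategory.Strict.id_comp _)).trans ?_
      exact backward_comp_forward (isPushout_of_zero_one rfl rfl _ _).flip
    exact h
  unit := bar SLin.nabla
  unit_mul := Subsingleton.elim _ _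
  comul_unit := Subsingleton.elim _ _

end CospanSLin

/-! Every map `f : X ⟶ Y` of sLin acts on the tensor powers of a Como-algebra covariantly, by
multiplications (`push f`), and contravariantly, by comultiplications (`pull f`). A cospan is sent
to `push` of its first leg followed by `pull` of its second; in Cospan(sLin) itself each cospan
factors in this way, so no other choice is possible.

On 1-cells, three facts are needed: functoriality of `push` and of `pull`, and the Beck-Chevalley
equation `pull f ≫ push g = push a ≫ pull b` for pushout squares (`pull_comp_push`). All three are
proved by induction on a normal form of monotone surjections, in which the last element is either
kept apart or merged with its predecessor. Normal forms are unique (`toHom_injective`), so the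
actions are defined by recursion and no presentation of sLin by relations is needed. The square that
merges the last two elements is the only non-trivial elementary case: under `push` it is
associativity, under `pull` coassociativity, and its two Beck-Chevalley equations are the Frobenius
laws. Separability handles a span whose two maps both merge the last two elements.

On 2-cells, separability and condition 4 make `push f` left adjoint to `pull f` with identity counit
(`ReflAdj`; the unit is unique, so asserting its existence is enough). Hence a 2-cell into `push l ≫
k` is determined by its whiskering with `pull l` (`whiskerLeft_injective`). A 2-cell between images
of cospans is called a cospan cell if its whiskering with `pull` of the first leg of the target is
an identity. There is at most one between given 1-cells, the unit of the adjunction supplies one for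
each 2-cell of Cospan(sLin), and the notion is closed under composition, whiskering and tensor. All
equations between 2-cells follow. Every 2-functor out of Cospan(sLin) preserves the identity
condition, which gives uniqueness on 2-cells. -/

/-! ## Identity 2-cells and reflective adjunctions -/

section IdentityCells

open scoped Bicategory

variable {B : Type u} [Bicategory.{w, v} B]

/-- A 2-cell that is an identity, up to an equality between its source and its target. -/
def IsIdCell {X Y : B} {f g : X ⟶ Y} (θ : f ⟶ g) : Prop := ∃ h : f = g, θ = eqToHom h

namespace IsIdCell

theorem of_eq {X Y : B} {f g : X ⟶ Y} (h : f = g) : IsIdCell (eqToHom h) := ⟨h, rfl⟩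

theorem id {X Y : B} (f : X ⟶ Y) : IsIdCell (𝟙 f) := ⟨rfl, rfl⟩

theorem comp {X Y : B} {f g h : X ⟶ Y} {θ : f ⟶ g} {θ' : g ⟶ h} (H : IsIdCell θ)
    (H' : IsIdCell θ') : IsIdCell (θ ≫ θ') := by
  obtain ⟨e, rfl⟩ := H
  obtain ⟨e', rfl⟩ := H'
  exact ⟨e.trans e', eqToHom_trans _ _⟩

theorem whiskerLeft {X Y Z : B} (k : X ⟶ Y) {f g : Y ⟶ Z} {θ : f ⟶ g} (H : IsIdCell θ) :
    IsIdCell (k ◁ θ) := by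
  obtain ⟨e, rfl⟩ := H
  exact ⟨congrArg (k ≫ ·) e, Bicategory.whiskerLeft_eqToHom _ _⟩

theorem whiskerRight {X Y Z : B} {f g : X ⟶ Y} {θ : f ⟶ g} (H : IsIdCell θ) (k : Y ⟶ Z) :
    IsIdCell (θ ▷ k) := by
  obtain ⟨e, rfl⟩ := H
  exact ⟨congrArg (· ≫ k) e, Bicategory.eqToHom_whiskerRight _ _⟩

theorem eq {X Y : B} {f g : X ⟶ Y} {θ θ' : f ⟶ g} (H : IsIdCell θ) (H' : IsIdCell θ') :
    θ = θ' := by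
  obtain ⟨e, rfl⟩ := H
  obtain ⟨e', rfl⟩ := H'
  rfl

/-- In a strict 2-category all coherence cells are `eqToHom`s. They can therefore be discarded when
the question is only whether a cell is an identity. -/
theorem conj_iff {X Y : B} {f g f' g' : X ⟶ Y} (e : f' = f) (θ : f ⟶ g) (e' : g = g') :
    IsIdCell (eqToHom e ≫ θ ≫ eqToHom e') ↔ IsIdCell θ := by
  subst e e'
  simp

theorem map₂ {C : Type u'} [Bicategory.{w', v'} C] (F : StrictPseudofunctor B C) {X Y : B}
    {f g : X ⟶ Y} {θ : f ⟶ g} (H : IsIdCell θ) : IsIdCell (F.map₂ θ) := by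
  obtain ⟨e, rfl⟩ := H
  exact ⟨congrArg F.map e, PrelaxFunctor.map₂_eqToHom _ _ _ _⟩

theorem prod {C : Type u'} [Bicategory.{w', v'} C] {X Y : B} {f g : X ⟶ Y} {θ : f ⟶ g}
    {X' Y' : C} {f' g' : X' ⟶ Y'} {θ' : f' ⟶ g'} (H : IsIdCell θ) (H' : IsIdCell θ') :
    IsIdCell (B := B × C) (X := (X, X')) (Y := (Y, Y')) (f := (f ×ₘ f')) (g := (g ×ₘ g'))
      (θ ×ₘ θ') := by
  obtain ⟨e, rfl⟩ := H
  obtain ⟨e', rfl⟩ := H'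
  subst e e'
  exact ⟨rfl, rfl⟩

/-- Rewriting the 1-cell changes the type of the whiskered 2-cell. As `IsIdCell` is a predicate, the
change costs no transport. -/
theorem congr_whiskerLeft {X Y Z : B} {k k' : X ⟶ Y} (e : k = k') {f g : Y ⟶ Z} {θ : f ⟶ g} :
    IsIdCell (k ◁ θ) ↔ IsIdCell (k' ◁ θ) := by
  subst e; rfl

theorem congr_whiskerRight {X Y Z : B} {k k' : Y ⟶ Z} (e : k = k') {f g : X ⟶ Y} {θ : f ⟶ g} :
    IsIdCell (θ ▷ k) ↔ IsIdCell (θ ▷ k') := by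
  subst e; rfl

variable [Bicategory.Strict B]

theorem comp_whiskerLeft {W X Y Z : B} (k : W ⟶ X) (l : X ⟶ Y) {f g : Y ⟶ Z} (θ : f ⟶ g) :
    IsIdCell ((k ≫ l) ◁ θ) ↔ IsIdCell (k ◁ l ◁ θ) := by
  rw [Bicategory.comp_whiskerLeft, Bicategory.Strict.associator_eqToIso,
    Bicategory.Strict.associator_eqToIso, eqToIso.hom, eqToIso.inv, conj_iff]

theorem whiskerRight_comp {W X Y Z : B} {f g : W ⟶ X} (θ : f ⟶ g) (k : X ⟶ Y) (l : Y ⟶ Z) :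
    IsIdCell (θ ▷ (k ≫ l)) ↔ IsIdCell (θ ▷ k ▷ l) := by
  rw [Bicategory.whiskerRight_comp, Bicategory.Strict.associator_eqToIso,
    Bicategory.Strict.associator_eqToIso, eqToIso.hom, eqToIso.inv, conj_iff]

theorem whisker_assoc {W X Y Z : B} (k : W ⟶ X) {f g : X ⟶ Y} (θ : f ⟶ g) (l : Y ⟶ Z) :
    IsIdCell ((k ◁ θ) ▷ l) ↔ IsIdCell (k ◁ (θ ▷ l)) := by
  rw [Bicategory.whisker_assoc, Bicategory.Strict.associator_eqToIso,
    Bicategory.Strict.associator_eqToIso, eqToIso.hom, eqToIso.inv, conj_iff]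

end IsIdCell

theorem CategoryTheory.StrictPseudofunctor.isIdCell_whiskerLeft {C : Type u'}
    [Bicategory.{w', v'} C] (F : StrictPseudofunctor B C) {X Y Z : B} (k : X ⟶ Y) {f g : Y ⟶ Z} {θ : f ⟶ g}
    (H : IsIdCell (k ◁ θ)) : IsIdCell (F.map k ◁ F.map₂ θ) := by
  have h := H.map₂ F
  rw [F.map₂_whisker_left, F.mapComp_eq_eqToIso, F.mapComp_eq_eqToIso, eqToIso.hom, eqToIso.inv,
    IsIdCell.conj_iff] at h
  exact h

theorem CategoryTheory.StrictPseudofunctor.isIdCell_whiskerRight {C : Type u'}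
    [Bicategory.{w', v'} C] (F : StrictPseudofunctor B C) {X Y Z : B} {f g : X ⟶ Y} {θ : f ⟶ g} (k : Y ⟶ Z)
    (H : IsIdCell (θ ▷ k)) : IsIdCell (F.map₂ θ ▷ F.map k) := by
  have h := H.map₂ F
  rw [F.map₂_whisker_right, F.mapComp_eq_eqToIso, F.mapComp_eq_eqToIso, eqToIso.hom, eqToIso.inv,
    IsIdCell.conj_iff] at h
  exact h

/-- `L` is left adjoint to `R`, with an identity as counit. -/
structure ReflAdj {X Y : B} (L : X ⟶ Y) (R : Y ⟶ X) : Prop where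
  counit : R ≫ L = 𝟙 Y
  exists_unit : ∃ η : 𝟙 X ⟶ L ≫ R, IsIdCell (η ▷ L) ∧ IsIdCell (R ◁ η)

namespace ReflAdj

theorem map {C : Type u'} [Bicategory.{w', v'} C] (F : StrictPseudofunctor B C) {X Y : B}
    {L : X ⟶ Y} {R : Y ⟶ X} (H : ReflAdj L R) : ReflAdj (F.map L) (F.map R) := by
  obtain ⟨h, η, h₁, h₂⟩ := H
  refine ⟨by rw [← F.map_comp, h, F.map_id], eqToHom (F.map_id X).symm ≫ F.map₂ η ≫
    eqToHom (F.map_comp L R), ?_, ?_⟩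
  · simp only [Bicategory.comp_whiskerRight, Bicategory.eqToHom_whiskerRight]
    exact (IsIdCell.conj_iff _ _ _).2 (F.isIdCell_whiskerRight L h₁)
  · simp only [Bicategory.whiskerLeft_comp, Bicategory.whiskerLeft_eqToHom]
    exact (IsIdCell.conj_iff _ _ _).2 (F.isIdCell_whiskerLeft R h₂)

theorem prod {C : Type u'} [Bicategory.{w', v'} C] {X Y : B} {L : X ⟶ Y} {R : Y ⟶ X}
    {X' Y' : C} {L' : X' ⟶ Y'} {R' : Y' ⟶ X'} (H : ReflAdj L R) (H' : ReflAdj L' R') :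
    ReflAdj (B := B × C) (X := (X, X')) (Y := (Y, Y')) (L ×ₘ L') (R ×ₘ R') := by
  obtain ⟨h, η, h₁, h₂⟩ := H
  obtain ⟨h', η', h₁', h₂'⟩ := H'
  exact ⟨Prod.ext h h', (η ×ₘ η'), h₁.prod h₁', h₂.prod h₂'⟩

theorem of_heq {X Y X' Y' : B} {L : X ⟶ Y} {R : Y ⟶ X} {L' : X' ⟶ Y'} {R' : Y' ⟶ X'}
    (H : ReflAdj L R) (hX : X = X') (hY : Y = Y') (hL : HEq L L') (hR : HEq R R') :
    ReflAdj L' R' := by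
  subst hX hY
  obtain rfl := eq_of_heq hL
  obtain rfl := eq_of_heq hR
  exact H

variable [Bicategory.Strict B]

theorem refl (X : B) : ReflAdj (𝟙 X) (𝟙 X) :=
  ⟨Bicategory.Strict.comp_id _, eqToHom (Bicategory.Strict.comp_id _).symm,
    (IsIdCell.of_eq _).whiskerRight _, (IsIdCell.of_eq _).whiskerLeft _⟩

theorem comp {X Y Z : B} {L : X ⟶ Y} {R : Y ⟶ X} {L' : Y ⟶ Z} {R' : Z ⟶ Y} (H : ReflAdj L R)
    (H' : ReflAdj L' R') : ReflAdj (L ≫ L') (R' ≫ R) := by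
  obtain ⟨h, η, h₁, h₂⟩ := H
  obtain ⟨h', η', h₁', h₂'⟩ := H'
  have e : (R' ≫ R) ≫ L ≫ L' = R' ≫ L' := by
    rw [Bicategory.Strict.assoc, ← Bicategory.Strict.assoc R, h, Bicategory.Strict.id_comp]
  refine ⟨e.trans h', η ≫ eqToHom (by rw [Bicategory.Strict.id_comp]) ≫ L ◁ η' ▷ R ≫
    eqToHom (by simp only [Bicategory.Strict.assoc]), ?_, ?_⟩
  · rw [Bicategory.comp_whiskerRight, Bicategory.comp_whiskerRight, Bicategory.comp_whiskerRight]
    refine .comp ((IsIdCell.whiskerRight_comp _ _ _).2 (h₁.whiskerRight _))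
      (.comp ((IsIdCell.of_eq _).whiskerRight _) (.comp ?_ ((IsIdCell.of_eq _).whiskerRight _)))
    -- After stripping `L` on the left, `η'` is whiskered with `R ≫ L ≫ L'`, which is `L'` by the
    -- counit of the first adjunction; the triangle identity of the second one then applies.
    rw [IsIdCell.whisker_assoc]
    refine .whiskerLeft _ ?_
    rw [← IsIdCell.whiskerRight_comp, IsIdCell.congr_whiskerRight (k' := L')]
    · exact h₁'
    · rw [← Bicategory.Strict.assoc, h, Bicategory.Strict.id_comp]
  · rw [Bicategory.whiskerLeft_comp, Bicategory.whiskerLeft_comp, Bicategory.whiskerLeft_comp]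
    refine .comp ((IsIdCell.comp_whiskerLeft _ _ _).2 (h₂.whiskerLeft _))
      (.comp ((IsIdCell.of_eq _).whiskerLeft _) (.comp ?_ ((IsIdCell.of_eq _).whiskerLeft _)))
    rw [← IsIdCell.comp_whiskerLeft, IsIdCell.congr_whiskerLeft (k' := R'),
      ← IsIdCell.whisker_assoc]
    · exact h₂'.whiskerRight _
    · rw [Bicategory.Strict.assoc, h, Bicategory.Strict.comp_id]

/-- A 2-cell into a composite `L ≫ k` is determined by its whiskering with the right adjoint. -/
theorem whiskerLeft_injective {X Y Z : B} {L : X ⟶ Y} {R : Y ⟶ X} (H : ReflAdj L R) {h : X ⟶ Z}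
    {k : Y ⟶ Z} {θ θ' : h ⟶ L ≫ k} (e : R ◁ θ = R ◁ θ') : θ = θ' := by
  obtain ⟨_, η, h₁, -⟩ := H
  -- By interchange, `η ▷ h` followed by `(L ≫ R) ◁ θ` equals `θ` followed by `η ▷ (L ≫ k)`. The
  -- latter is an identity because `η ▷ L` is one, so `θ` is recovered from `R ◁ θ`.
  have key : ∀ θ : h ⟶ L ≫ k, θ = (λ_ h).inv ≫ (η ▷ h ≫ (L ≫ R) ◁ θ) ≫
      eqToHom (by obtain ⟨h₁, -⟩ := h₁
                  rw [← Bicategory.Strict.assoc, ← h₁, Bicategory.Strict.id_comp]) := by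
    intro θ
    have : IsIdCell (η ▷ (L ≫ k)) := (IsIdCell.whiskerRight_comp _ _ _).2 (h₁.whiskerRight k)
    obtain ⟨e', h'⟩ := this
    rw [← Bicategory.whisker_exchange, h', Bicategory.id_whiskerLeft]
    simp [Bicategory.Strict.leftUnitor_eqToIso]
  rw [key θ, key θ', Bicategory.comp_whiskerLeft, e, Bicategory.comp_whiskerLeft]

theorem eq_of_isIdCell {X Y Z : B} {L : X ⟶ Y} {R : Y ⟶ X} (H : ReflAdj L R) {h g : X ⟶ Z}
    {k : Y ⟶ Z} (hg : g = L ≫ k) {θ θ' : h ⟶ g} (e : IsIdCell (R ◁ θ))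
    (e' : IsIdCell (R ◁ θ')) : θ = θ' := by
  subst hg
  exact H.whiskerLeft_injective (e.eq e')

/-- The form of the previous criterion for cells whose boundaries agree only propositionally. It
settles preservation of units, compatibility with the tensor, and uniqueness on 2-cells. -/
theorem heq_of_isIdCell {X Y Z X' Y' Z' : B} (hX : X = X') (hY : Y = Y') (hZ : Z = Z')
    {L : X ⟶ Y} {R : Y ⟶ X} (H : ReflAdj L R) {R' : Y' ⟶ X'} (hR : HEq R R') {h g : X ⟶ Z}
    {h' g' : X' ⟶ Z'} (eh : HEq h h') (eg : HEq g g') {k : Y ⟶ Z} (hg : g = L ≫ k)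
    {θ : h ⟶ g} {θ' : h' ⟶ g'} (e : IsIdCell (R ◁ θ)) (e' : IsIdCell (R' ◁ θ')) :
    HEq θ θ' := by
  subst hX hY hZ
  obtain rfl := eq_of_heq hR
  obtain rfl := eq_of_heq eh
  obtain rfl := eq_of_heq eg
  exact heq_of_eq (H.eq_of_isIdCell hg e e')

end ReflAdj

end IdentityCells

/-! ### Heterogeneous equality of composites in a strict 2-category. -/

section

variable {B : Type u} [Bicategory.{w, v} B]

theorem CategoryTheory.Bicategory.comp_heq {X Y Z X' Y' Z' : B} (hX : X = X')
    (hY : Y = Y') (hZ : Z = Z') {f : X ⟶ Y} {g : Y ⟶ Z} {f' : X' ⟶ Y'} {g' : Y' ⟶ Z'} (hf : HEq f f') (hg : HEq g g') :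
    HEq (f ≫ g) (f' ≫ g') := by
  subst hX hY hZ
  obtain rfl := eq_of_heq hf
  obtain rfl := eq_of_heq hg
  rfl

theorem CategoryTheory.Bicategory.id_heq {X Y : B} (h : X = Y) : HEq (𝟙 X) (𝟙 Y) := by subst h; rfl

theorem CategoryTheory.Bicategory.eqToHom_comp_heq [Bicategory.Strict B] {X Y Z : B}
    (h : X = Y) (f : Y ⟶ Z) : HEq (eqToHom h ≫ f) f := by
  subst h
  exact heq_of_eq (Bicategory.Strict.id_comp f)

theorem CategoryTheory.Bicategory.comp_eqToHom_heq [Bicategory.Strict B] {X Y Z : B}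
    (f : X ⟶ Y) (h : Y = Z) : HEq (f ≫ eqToHom h) f := by
  subst h
  exact heq_of_eq (Bicategory.Strict.comp_id f)

theorem CategoryTheory.Bicategory.eqToHom_comp_eqToHom [Bicategory.Strict B] {X Y Z : B}
    (h : X = Y) (h' : Y = Z) : eqToHom h ≫ eqToHom h' = eqToHom (h.trans h') := by
  subst h h'
  exact Bicategory.Strict.id_comp _

end

/-! ## Strict monoidal calculus -/

namespace StrictMonoidalTwoCategory

variable {B : Type u} [Bicategory.{w, v} B] [Bicategory.Strict B] [StrictMonoidalTwoCategory B]

theorem tensorHom_id (X Y : B) : tensorHom (𝟙 X) (𝟙 Y) = 𝟙 (tensorObj X Y) :=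
  tensor.map_id (X, Y)

theorem tensorHom_comp {X Y X' Y' X'' Y'' : B} (f : X ⟶ X') (g : Y ⟶ Y') (f' : X' ⟶ X'')
    (g' : Y' ⟶ Y'') : tensorHom (f ≫ f') (g ≫ g') = tensorHom f g ≫ tensorHom f' g' :=
  tensor.map_comp (f ×ₘ g) (f' ×ₘ g')

theorem tensorHom_heq {X Y X' Y' Z W Z' W' : B} (hX : X = Z) (hX' : X' = Z') (hY : Y = W)
    (hY' : Y' = W') {f : X ⟶ X'} {g : Y ⟶ Y'} {f' : Z ⟶ Z'} {g' : W ⟶ W'} (hf : HEq f f')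
    (hg : HEq g g') : HEq (tensorHom f g) (tensorHom f' g') := by
  subst hX hX' hY hY'
  obtain rfl := eq_of_heq hf
  obtain rfl := eq_of_heq hg
  rfl

theorem _root_.ReflAdj.tensor {X Y X' Y' : B} {L : X ⟶ Y} {R : Y ⟶ X} {L' : X' ⟶ Y'}
    {R' : Y' ⟶ X'} (H : ReflAdj L R) (H' : ReflAdj L' R') :
    ReflAdj (tensorHom L L') (tensorHom R R') :=
  (H.prod H').map StrictMonoidalTwoCategory.tensor

open scoped Bicategory in
theorem _root_.IsIdCell.tensor {X Y Z X' Y' Z' : B} {k : X ⟶ Y} {f g : Y ⟶ Z} {θ : f ⟶ g}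
    {k' : X' ⟶ Y'} {f' g' : Y' ⟶ Z'} {θ' : f' ⟶ g'} (H : IsIdCell (k ◁ θ))
    (H' : IsIdCell (k' ◁ θ')) : IsIdCell (tensorHom k k' ◁ tensorHom₂ θ θ') :=
  StrictPseudofunctor.isIdCell_whiskerLeft StrictMonoidalTwoCategory.tensor (k ×ₘ k')
    (H.prod H')

end StrictMonoidalTwoCategory

theorem ComoAlgebra.reflAdj {B : Type u} [Bicategory.{w, v} B] [Bicategory.Strict B]
    [StrictMonoidalTwoCategory B] (A : ComoAlgebra B) : ReflAdj A.mul A.comul :=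
  ⟨A.separable, A.unit, ⟨_, A.unit_mul⟩, ⟨_, A.comul_unit⟩⟩

/-! ## Normal forms of the maps of `sLin` -/

namespace SLin

/-- The map `n + 1 + 1 ⟶ n + 1` identifying the last two elements. -/
def mergeLast (n : ℕ) : SLin.mk (n + 2) ⟶ SLin.mk (n + 1) := sumMap (𝟙 (SLin.mk n)) nabla

/-- The ordinal sum of a map with the identity of `1`. -/
def keepLast {n m : ℕ} (f : SLin.mk n ⟶ SLin.mk m) : SLin.mk (n + 1) ⟶ SLin.mk (m + 1) :=
  sumMap f (𝟙 (SLin.mk 1))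

theorem mergeLast_apply (n i : ℕ) (hi : i < n + 2) :
    ((mergeLast n).toFun ⟨i, hi⟩).val = min i n := by
  rcases lt_or_ge i n with h | h
  · exact (sumMap_of_lt (𝟙 (SLin.mk n)) nabla i hi h).trans (min_eq_left h.le).symm
  · exact (sumMap_of_le (𝟙 (SLin.mk n)) nabla i hi h).trans (min_eq_right h).symm

theorem keepLast_apply_of_lt {n m : ℕ} (f : SLin.mk n ⟶ SLin.mk m) (i : ℕ) (hi : i < n + 1)
    (h : i < n) : ((keepLast f).toFun ⟨i, hi⟩).val = (f.toFun ⟨i, h⟩).val :=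
  sumMap_of_lt f (𝟙 (SLin.mk 1)) i hi h

theorem keepLast_apply_last {n m : ℕ} (f : SLin.mk n ⟶ SLin.mk m) (hn : n < n + 1) :
    ((keepLast f).toFun ⟨n, hn⟩).val = m := by
  refine (sumMap_of_le f (𝟙 (SLin.mk 1)) n hn le_rfl).trans ?_
  simp

theorem keepLast_injective {n m : ℕ} {f g : SLin.mk n ⟶ SLin.mk m} (h : keepLast f = keepLast g) :
    f = g :=
  hom_ext fun i => Fin.ext <| by
    rw [← keepLast_apply_of_lt f i.1 (by lia) i.2, h, keepLast_apply_of_lt]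

theorem keepLast_id (n : ℕ) : keepLast (𝟙 (SLin.mk n)) = 𝟙 (SLin.mk (n + 1)) := endo_eq_id _

theorem keepLast_comp {n m p : ℕ} (f : SLin.mk n ⟶ SLin.mk m) (g : SLin.mk m ⟶ SLin.mk p) :
    keepLast (f ≫ g) = keepLast f ≫ keepLast g := by
  have := sumMap_comp f (𝟙 (SLin.mk 1)) g (𝟙 (SLin.mk 1))
  rwa [Category.comp_id] at this

/-- A square that merges the last two elements is a pushout. -/
theorem isPushout_mergeLast_keepLast {n m : ℕ} (f : SLin.mk (n + 1) ⟶ SLin.mk (m + 1)) :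
    IsPushout (mergeLast n) (keepLast f) f (mergeLast m) := by
  -- A monotone surjection sends the last element to the last element.
  have hlast : (f.toFun (⟨n, n.lt_succ_self⟩ : Fin (n + 1))).val = m := by
    obtain ⟨⟨i, hi⟩, e⟩ := f.surj (⟨m, m.lt_succ_self⟩ : Fin (m + 1))
    have h₁ : f.toFun ⟨i, hi⟩ ≤ f.toFun (⟨n, n.lt_succ_self⟩ : Fin (n + 1)) :=
      f.toFun.monotone (Fin.mk_le_mk.2 (Nat.le_of_lt_succ hi))
    rw [e, Fin.le_def] at h₁
    exact le_antisymm (Nat.le_of_lt_succ (Fin.isLt _)) h₁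
  have w : mergeLast n ≫ f = keepLast f ≫ mergeLast m := by
    refine hom_ext fun ⟨i, hi⟩ => Fin.ext ?_
    have hi' : i < n + 2 := hi
    have h₀ := mergeLast_apply n i hi
    refine Eq.trans ?_ (mergeLast_apply m _ ((keepLast f).toFun ⟨i, hi⟩).isLt).symm
    rcases lt_or_ge i (n + 1) with h | h
    · rw [keepLast_apply_of_lt f i hi h, comp_apply,
        show (mergeLast n).toFun ⟨i, hi⟩ = ⟨i, h⟩ from Fin.ext (h₀.trans (by lia))]
      exact (min_eq_left (Nat.le_of_lt_succ (Fin.isLt _))).symm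
    · obtain rfl : i = n + 1 := by lia
      rw [keepLast_apply_last, comp_apply,
        show (mergeLast n).toFun ⟨n + 1, hi⟩ = ⟨n, by lia⟩ from Fin.ext (h₀.trans (by lia)), hlast]
      lia
  refine isPushout_of_adjacent w fun i hi e => ?_
  have hi' : i + 1 < n + 2 := hi
  -- The neighbours `n` and `n + 1` are identified by `mergeLast n`. Lower neighbours are fixed by
  -- it, so there `f` makes the identification, and `keepLast f` agrees with `f`.
  rcases (show i ≤ n by lia).eq_or_lt with rfl | h
  · exact .inl (Fin.ext (by rw [mergeLast_apply, mergeLast_apply]; lia))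
  · right
    have e' : (f.toFun ⟨i, by lia⟩).val = (f.toFun ⟨i + 1, by lia⟩).val := by
      rw [comp_apply, comp_apply,
        show (mergeLast n).toFun ⟨i, by lia⟩ = ⟨i, by lia⟩ from
          Fin.ext ((mergeLast_apply n i _).trans (by lia)),
        show (mergeLast n).toFun ⟨i + 1, hi⟩ = ⟨i + 1, by lia⟩ from
          Fin.ext ((mergeLast_apply n (i + 1) _).trans (by lia))] at e
      exact congrArg Fin.val e
    exact Fin.ext (by rw [keepLast_apply_of_lt f i _ (by lia),
      keepLast_apply_of_lt f (i + 1) _ (by lia), e'])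

/-- Normal forms of the maps `n ⟶ m` of `sLin`: the last element is either kept apart from its
predecessor, or merged with it. -/
inductive Word : ℕ → ℕ → Type
  | nil : Word 0 0
  | keep {n m : ℕ} (w : Word n m) : Word (n + 1) (m + 1)
  | merge {n m : ℕ} (w : Word (n + 1) m) : Word (n + 2) m

namespace Word

/-- The map described by a word. -/
def toHom : {n m : ℕ} → Word n m → (SLin.mk n ⟶ SLin.mk m)
  | _, _, nil => 𝟙 _
  | _, _, keep w => keepLast w.toHom
  | _, _, @merge n _ w => mergeLast n ≫ w.toHom

theorem exists_toHom_eq {n : ℕ} : ∀ {m : ℕ} (f : SLin.mk n ⟶ SLin.mk m),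
    ∃ w : Word n m, w.toHom = f := by
  induction n with
  | zero =>
    rintro (_ | m) f
    · exact ⟨nil, (endo_eq_id f).symm⟩
    · obtain ⟨i, -⟩ := f.surj (0 : Fin (m + 1))
      exact i.elim0
  | succ n ih =>
    rintro (_ | m) f
    · exact (f.toFun (0 : Fin (n + 1))).elim0
    have hlast : (f.toFun (⟨n, n.lt_succ_self⟩ : Fin (n + 1))).val = m := by
      obtain ⟨⟨i, hi⟩, e⟩ := f.surj (⟨m, m.lt_succ_self⟩ : Fin (m + 1))
      have h₁ : f.toFun ⟨i, hi⟩ ≤ f.toFun (⟨n, n.lt_succ_self⟩ : Fin (n + 1)) :=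
        f.toFun.monotone (Fin.mk_le_mk.2 (Nat.le_of_lt_succ hi))
      rw [e, Fin.le_def] at h₁
      exact le_antisymm (Nat.le_of_lt_succ (Fin.isLt _)) h₁
    -- The question is whether the last element is alone in its fibre. If it is, `f` is the sum of
    -- its restriction `g` with the identity of `1`.
    by_cases H : ∀ i (hi : i < n), (f.toFun (⟨i, by lia⟩ : Fin (n + 1))).val < m
    · let g : SLin.mk n ⟶ SLin.mk m :=
        ⟨⟨fun i => ⟨_, H i.1 i.2⟩, fun i j hij => f.toFun.monotone (Fin.mk_le_mk.2 hij)⟩, by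
          intro (j : Fin m)
          obtain ⟨⟨i, hi⟩, e⟩ := f.surj (⟨j.1, by lia⟩ : Fin (m + 1))
          have e' := congrArg Fin.val e
          dsimp only at e'
          refine ⟨⟨i, lt_of_le_of_ne (Nat.le_of_lt_succ hi) ?_⟩, Fin.ext e'⟩
          rintro rfl
          lia⟩
      obtain ⟨w, hw⟩ := ih g
      refine ⟨keep w, hom_ext fun ⟨i, hi⟩ => Fin.ext ?_⟩
      rw [toHom, hw]
      rcases (Nat.le_of_lt_succ hi).eq_or_lt with rfl | h
      · rw [keepLast_apply_last, hlast]
      · rw [keepLast_apply_of_lt g i hi h]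
        rfl
    · push Not at H
      obtain ⟨i, hi, h⟩ := H
      -- Some earlier element also goes to `m`; by monotonicity so does the last but one, and `f`
      -- factors through the merging of the last two elements.
      obtain ⟨n, rfl⟩ : ∃ k, n = k + 1 := ⟨n - 1, by lia⟩
      have h₁ : (f.toFun (⟨n, by lia⟩ : Fin (n + 2))).val = m := by
        refine le_antisymm (Nat.le_of_lt_succ (Fin.isLt _)) (h.trans ?_)
        exact f.toFun.monotone (Fin.mk_le_mk.2 (by lia))
      obtain ⟨t, ht⟩ := exists_factor (mergeLast n) f (fibres_of_adjacent _ _ fun i hi e => by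
        have hi' : i + 1 < n + 2 := hi
        have := congrArg Fin.val e
        rw [mergeLast_apply, mergeLast_apply] at this
        obtain rfl : i = n := by lia
        exact Fin.ext (h₁.trans hlast.symm))
      obtain ⟨w, rfl⟩ := ih t
      exact ⟨merge w, ht⟩

theorem not_succ_zero {n : ℕ} (w : Word (n + 1) 0) : False :=
  (w.toHom.toFun (0 : Fin (n + 1))).elim0

/-- The last two elements are separated by the first map and identified by the second. -/
theorem toHom_keep_ne_toHom_merge {n m : ℕ} (w : Word (n + 1) m) (w' : Word (n + 1) (m + 1)) :
    (keep w).toHom ≠ (merge w').toHom := by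
  intro h
  have h₁ := congr_apply h (⟨n, by simp⟩ : Fin (n + 2))
  have h₂ := congr_apply h (⟨n + 1, by simp⟩ : Fin (n + 2))
  have h₃ : (mergeLast n).toFun (⟨n, by simp⟩ : Fin (n + 2)) =
      (mergeLast n).toFun (⟨n + 1, by simp⟩ : Fin (n + 2)) :=
    Fin.ext (by rw [mergeLast_apply, mergeLast_apply]; lia)
  rw [toHom, toHom, comp_apply, Fin.ext_iff] at h₁ h₂
  rw [keepLast_apply_last] at h₂
  rw [keepLast_apply_of_lt _ n _ (by lia), h₃, ← h₂] at h₁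
  exact (w.toHom.toFun _).isLt.ne h₁

/-- This makes recursion on words a legitimate definition on maps. Merging letters cancel because
all maps of sLin are epimorphisms. -/
theorem toHom_injective {n m : ℕ} (w w' : Word n m) (h : w.toHom = w'.toHom) : w = w' := by
  induction w with
  | nil => cases w'; rfl
  | keep w ih =>
    cases w' with
    | keep w' => rw [ih w' (keepLast_injective h)]
    | merge w' => exact absurd h (toHom_keep_ne_toHom_merge _ _)
  | merge w ih =>
    cases w' with
    | keep w' => exact absurd h.symm (toHom_keep_ne_toHom_merge _ _)
    | merge w' => rw [ih w' ((cancel_epi _).1 h)]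

/-- The word of a map. -/
noncomputable def ofHom {n m : ℕ} (f : SLin.mk n ⟶ SLin.mk m) : Word n m :=
  (exists_toHom_eq f).choose

@[simp] theorem toHom_ofHom {n m : ℕ} (f : SLin.mk n ⟶ SLin.mk m) : (ofHom f).toHom = f :=
  (exists_toHom_eq f).choose_spec

@[simp] theorem ofHom_toHom {n m : ℕ} (w : Word n m) : ofHom w.toHom = w :=
  toHom_injective _ _ (toHom_ofHom _)

end Word

end SLin

/-! ## The action of the maps of `sLin` on the powers of a Como-algebra -/

namespace ComoAlgebra

variable {B : Type u} [Bicategory.{w, v} B] [Bicategory.Strict B] [StrictMonoidalTwoCategory B]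
  (A : ComoAlgebra B)

/-- The tensor powers of the carrier. -/
@[reducible] def power : ℕ → B
  | 0 => StrictMonoidalTwoCategory.unit
  | n + 1 => tensorObj (power n) A.carrier

/-- Tensoring on the right with the identity of the carrier. -/
abbrev stab {n m : ℕ} (f : A.power n ⟶ A.power m) : A.power (n + 1) ⟶ A.power (m + 1) :=
  tensorHom f (𝟙 A.carrier)

theorem stab_comp {n m p : ℕ} (f : A.power n ⟶ A.power m) (g : A.power m ⟶ A.power p) :
    A.stab (f ≫ g) = A.stab f ≫ A.stab g := by
  rw [stab, stab, stab, ← tensorHom_comp, Bicategory.Strict.id_comp]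

theorem stab_id (n : ℕ) : A.stab (𝟙 (A.power n)) = 𝟙 (A.power (n + 1)) := tensorHom_id _ _

/-- The multiplication of the last two factors. -/
def mulLast (n : ℕ) : A.power (n + 2) ⟶ A.power (n + 1) :=
  assocHom (A.power n) A.carrier A.carrier ≫ tensorHom (𝟙 (A.power n)) A.mul

/-- The comultiplication of the last factor. -/
def comulLast (n : ℕ) : A.power (n + 1) ⟶ A.power (n + 2) :=
  tensorHom (𝟙 (A.power n)) A.comul ≫ assocInv (A.power n) A.carrier A.carrier

theorem power_add_two (n : ℕ) :
    A.power (n + 2) = tensorObj (A.power n) (tensorObj A.carrier A.carrier) := assoc_obj _ _ _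

theorem power_add_three (n : ℕ) : A.power (n + 3) =
    tensorObj (A.power n) (tensorObj (tensorObj A.carrier A.carrier) A.carrier) :=
  (congrArg (tensorObj · A.carrier) (A.power_add_two n)).trans (assoc_obj _ _ _)

/-- Powers are bracketed to the left, while the multiplication acts on a bracketed pair. Up to `HEq`
the rebracketing disappears, and laws of the algebra transfer to the last factors by tensoring with
an identity on the left. -/
theorem mulLast_heq (n : ℕ) : HEq (A.mulLast n) (tensorHom (𝟙 (A.power n)) A.mul) :=
  Bicategory.eqToHom_comp_heq _ _

theorem comulLast_heq (n : ℕ) : HEq (A.comulLast n) (tensorHom (𝟙 (A.power n)) A.comul) :=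
  Bicategory.comp_eqToHom_heq _ _

theorem stab_mulLast_heq (n : ℕ) : HEq (A.stab (A.mulLast n))
    (tensorHom (𝟙 (A.power n)) (tensorHom A.mul (𝟙 A.carrier))) :=
  (tensorHom_heq (A.power_add_two n) rfl rfl rfl (A.mulLast_heq n) .rfl).trans (assoc_map _ _ _)

theorem stab_comulLast_heq (n : ℕ) : HEq (A.stab (A.comulLast n))
    (tensorHom (𝟙 (A.power n)) (tensorHom A.comul (𝟙 A.carrier))) :=
  (tensorHom_heq rfl (A.power_add_two n) rfl rfl (A.comulLast_heq n) .rfl).trans (assoc_map _ _ _)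

theorem mulLast_succ_heq (n : ℕ) : HEq (A.mulLast (n + 1)) (tensorHom (𝟙 (A.power n))
    (assocHom A.carrier A.carrier A.carrier ≫ tensorHom (𝟙 A.carrier) A.mul)) := by
  refine (A.mulLast_heq (n + 1)).trans (.trans ?_ (tensorHom_heq rfl rfl (assoc_obj _ _ _).symm rfl
    .rfl (Bicategory.eqToHom_comp_heq _ _).symm))
  rw [← A.stab_id n]
  exact assoc_map _ _ _

theorem comulLast_succ_heq (n : ℕ) : HEq (A.comulLast (n + 1)) (tensorHom (𝟙 (A.power n))
    (tensorHom (𝟙 A.carrier) A.comul ≫ assocInv A.carrier A.carrier A.carrier)) := by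
  refine (A.comulLast_heq (n + 1)).trans (.trans ?_ (tensorHom_heq rfl rfl rfl
    (assoc_obj _ _ _).symm .rfl (Bicategory.comp_eqToHom_heq _ _).symm))
  rw [← A.stab_id n]
  exact assoc_map _ _ _

theorem id_tensorHom_comp (X : B) {Y Z W : B} (f : Y ⟶ Z) (g : Z ⟶ W) :
    tensorHom (𝟙 X) f ≫ tensorHom (𝟙 X) g = tensorHom (𝟙 X) (f ≫ g) := by
  rw [← tensorHom_comp, Bicategory.Strict.comp_id]

theorem comulLast_comp_mulLast (n : ℕ) : A.comulLast n ≫ A.mulLast n = 𝟙 (A.power (n + 1)) := by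
  refine eq_of_heq ((Bicategory.comp_heq rfl (A.power_add_two n) rfl (A.comulLast_heq n)
    (A.mulLast_heq n)).trans (heq_of_eq ?_))
  rw [id_tensorHom_comp, A.separable, tensorHom_id]

/-- Interchange: `f` acts on the first factors, the multiplication on the last two. -/
theorem stab_stab_comp_mulLast {n m : ℕ} (f : A.power n ⟶ A.power m) :
    A.stab (A.stab f) ≫ A.mulLast m = A.mulLast n ≫ A.stab f := by
  have h : HEq (A.stab (A.stab f)) (tensorHom f (𝟙 (tensorObj A.carrier A.carrier))) := by
    rw [← tensorHom_id]
    exact assoc_map _ _ _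
  refine eq_of_heq ((Bicategory.comp_heq (A.power_add_two n) (A.power_add_two m) rfl h
    (A.mulLast_heq m)).trans (.trans (heq_of_eq ?_) (Bicategory.comp_heq (A.power_add_two n) rfl rfl
    (A.mulLast_heq n) .rfl).symm))
  rw [← tensorHom_comp]
  refine .trans ?_ (tensorHom_comp _ _ _ _)
  simp only [Bicategory.Strict.comp_id, Bicategory.Strict.id_comp]

theorem comulLast_comp_stab_stab {n m : ℕ} (f : A.power n ⟶ A.power m) :
    A.comulLast n ≫ A.stab (A.stab f) = A.stab f ≫ A.comulLast m := by
  have h : HEq (A.stab (A.stab f)) (tensorHom f (𝟙 (tensorObj A.carrier A.carrier))) := by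
    rw [← tensorHom_id]
    exact assoc_map _ _ _
  refine eq_of_heq ((Bicategory.comp_heq rfl (A.power_add_two n) (A.power_add_two m)
    (A.comulLast_heq n) h).trans (.trans (heq_of_eq ?_) (Bicategory.comp_heq rfl rfl
    (A.power_add_two m) .rfl (A.comulLast_heq m)).symm))
  rw [← tensorHom_comp]
  refine .trans ?_ (tensorHom_comp _ _ _ _)
  simp only [Bicategory.Strict.comp_id, Bicategory.Strict.id_comp]

theorem stab_mulLast_comp_mulLast (n : ℕ) :
    A.stab (A.mulLast n) ≫ A.mulLast n = A.mulLast (n + 1) ≫ A.mulLast n := by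
  refine eq_of_heq ((Bicategory.comp_heq (A.power_add_three n) (A.power_add_two n) rfl
    (A.stab_mulLast_heq n) (A.mulLast_heq n)).trans (.trans (heq_of_eq ?_)
    (Bicategory.comp_heq (A.power_add_three n) (A.power_add_two n) rfl
    (A.mulLast_succ_heq n) (A.mulLast_heq n)).symm))
  rw [id_tensorHom_comp, id_tensorHom_comp, A.assoc, Bicategory.Strict.assoc]

theorem comulLast_comp_stab_comulLast (n : ℕ) :
    A.comulLast n ≫ A.stab (A.comulLast n) = A.comulLast n ≫ A.comulLast (n + 1) := by
  refine eq_of_heq ((Bicategory.comp_heq rfl (A.power_add_two n) (A.power_add_three n)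
    (A.comulLast_heq n) (A.stab_comulLast_heq n)).trans (.trans (heq_of_eq ?_)
    (Bicategory.comp_heq rfl (A.power_add_two n) (A.power_add_three n)
    (A.comulLast_heq n) (A.comulLast_succ_heq n)).symm))
  rw [id_tensorHom_comp, id_tensorHom_comp, ← Bicategory.Strict.assoc A.comul, ← A.coassoc]
  simp only [Bicategory.Strict.assoc, Bicategory.eqToHom_comp_eqToHom, eqToHom_refl,
    Bicategory.Strict.comp_id]

/-- The first Frobenius law on the last factors; the second one is `comulLast_comp_stab_mulLast`. -/
theorem stab_comulLast_comp_mulLast (n : ℕ) :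
    A.stab (A.comulLast n) ≫ A.mulLast (n + 1) = A.mulLast n ≫ A.comulLast n := by
  refine eq_of_heq ((Bicategory.comp_heq (A.power_add_two n) (A.power_add_three n)
    (A.power_add_two n) (A.stab_comulLast_heq n) (A.mulLast_succ_heq n)).trans
    (.trans (heq_of_eq ?_) (Bicategory.comp_heq (A.power_add_two n) rfl (A.power_add_two n)
    (A.mulLast_heq n) (A.comulLast_heq n)).symm))
  rw [id_tensorHom_comp, A.frobenius_left]
  exact (id_tensorHom_comp _ _ _).symm

theorem comulLast_comp_stab_mulLast (n : ℕ) :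
    A.comulLast (n + 1) ≫ A.stab (A.mulLast n) = A.mulLast n ≫ A.comulLast n := by
  refine eq_of_heq ((Bicategory.comp_heq (A.power_add_two n) (A.power_add_three n)
    (A.power_add_two n) (A.comulLast_succ_heq n) (A.stab_mulLast_heq n)).trans
    (.trans (heq_of_eq ?_) (Bicategory.comp_heq (A.power_add_two n) rfl (A.power_add_two n)
    (A.mulLast_heq n) (A.comulLast_heq n)).symm))
  rw [id_tensorHom_comp, Bicategory.Strict.assoc, A.frobenius_right]
  exact (id_tensorHom_comp _ _ _).symm

theorem reflAdj_last (n : ℕ) : ReflAdj (A.mulLast n) (A.comulLast n) :=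
  ((ReflAdj.refl (A.power n)).tensor A.reflAdj).of_heq (A.power_add_two n).symm rfl
    (A.mulLast_heq n).symm (A.comulLast_heq n).symm

end ComoAlgebra

/-! ### Direct and inverse images along words -/

namespace ComoAlgebra

open SLin

variable {B : Type u} [Bicategory.{w, v} B] [Bicategory.Strict B] [StrictMonoidalTwoCategory B]
  (A : ComoAlgebra B)

/-- The 1-cell of multiplications described by a word. -/
def pushWord : {n m : ℕ} → Word n m → (A.power n ⟶ A.power m)
  | _, _, .nil => 𝟙 _
  | _, _, .keep w => A.stab (pushWord w)
  | _, _, @Word.merge n _ w => A.mulLast n ≫ pushWord w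

/-- The 1-cell of comultiplications described by a word. -/
def pullWord : {n m : ℕ} → Word n m → (A.power m ⟶ A.power n)
  | _, _, .nil => 𝟙 _
  | _, _, .keep w => A.stab (pullWord w)
  | _, _, @Word.merge n _ w => pullWord w ≫ A.comulLast n

theorem reflAdj_word {n m : ℕ} (w : Word n m) : ReflAdj (A.pushWord w) (A.pullWord w) := by
  induction w with
  | nil => exact .refl _
  | keep w ih => exact ih.tensor (.refl _)
  | merge w ih => exact (A.reflAdj_last _).comp ih

/-- The `push` image of the commuting square in `isPushout_mergeLast_keepLast`. A kept last element
is a matter of interchange, a merged one of associativity. -/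
theorem stab_pushWord_comp_mulLast : {n m : ℕ} → (w : Word (n + 1) (m + 1)) →
    A.stab (A.pushWord w) ≫ A.mulLast m = A.mulLast n ≫ A.pushWord w
  | _, _, .keep _ => A.stab_stab_comp_mulLast _
  | n + 1, _, .merge w => by
    rw [pushWord, stab_comp, Bicategory.Strict.assoc, stab_pushWord_comp_mulLast w,
      ← Bicategory.Strict.assoc,
      stab_mulLast_comp_mulLast, Bicategory.Strict.assoc]

theorem comulLast_comp_stab_pullWord : {n m : ℕ} → (w : Word (n + 1) (m + 1)) →
    A.comulLast m ≫ A.stab (A.pullWord w) = A.pullWord w ≫ A.comulLast n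
  | _, _, .keep _ => A.comulLast_comp_stab_stab _
  | n + 1, _, .merge w => by
    rw [pullWord, stab_comp, ← Bicategory.Strict.assoc, comulLast_comp_stab_pullWord w,
      Bicategory.Strict.assoc, comulLast_comp_stab_comulLast, Bicategory.Strict.assoc]

/-- Beck-Chevalley for the same square, with the merging pulled back and `w` pushed forward; the
merge case is `frobenius_right`. The next lemma is the transposed equation, from `frobenius_left`.
-/
theorem comulLast_comp_stab_pushWord : {n m : ℕ} → (w : Word (n + 1) (m + 1)) →
    A.comulLast n ≫ A.stab (A.pushWord w) = A.pushWord w ≫ A.comulLast m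
  | _, _, .keep _ => A.comulLast_comp_stab_stab _
  | n + 1, _, .merge w => by
    rw [pushWord, stab_comp, ← Bicategory.Strict.assoc, comulLast_comp_stab_mulLast,
      Bicategory.Strict.assoc, comulLast_comp_stab_pushWord w, Bicategory.Strict.assoc]

theorem stab_pullWord_comp_mulLast : {n m : ℕ} → (w : Word (n + 1) (m + 1)) →
    A.stab (A.pullWord w) ≫ A.mulLast n = A.mulLast m ≫ A.pullWord w
  | _, _, .keep _ => A.stab_stab_comp_mulLast _
  | n + 1, _, .merge w => by
    rw [pullWord, stab_comp, Bicategory.Strict.assoc, stab_comulLast_comp_mulLast,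
      ← Bicategory.Strict.assoc, stab_pullWord_comp_mulLast w, Bicategory.Strict.assoc]

/-- The normal form of a composite is found together with its two actions, so functoriality of
`push` and `pull` comes out of one induction. -/
theorem exists_word_comp {n m : ℕ} (w : Word n m) : ∀ {p : ℕ} (w' : Word m p), ∃ w'' : Word n p,
    w''.toHom = w.toHom ≫ w'.toHom ∧ A.pushWord w'' = A.pushWord w ≫ A.pushWord w' ∧
      A.pullWord w'' = A.pullWord w' ≫ A.pullWord w := by
  induction w with
  | nil =>
    intro p w'
    cases w'
    exact ⟨.nil, (Category.id_comp _).symm, (Bicategory.Strict.id_comp _).symm,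
      (Bicategory.Strict.id_comp _).symm⟩
  | merge w ih =>
    intro p w'
    obtain ⟨w'', h₁, h₂, h₃⟩ := ih w'
    exact ⟨.merge w'', by rw [Word.toHom, Word.toHom, h₁, Category.assoc],
      by rw [pushWord, pushWord, h₂, Bicategory.Strict.assoc],
      by rw [pullWord, pullWord, h₃, Bicategory.Strict.assoc]⟩
  | @keep n m w ih =>
    intro p w'
    cases w' with
    | keep w' =>
      obtain ⟨w'', h₁, h₂, h₃⟩ := ih w'
      exact ⟨.keep w'', by rw [Word.toHom, Word.toHom, Word.toHom, h₁, keepLast_comp],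
        by rw [pushWord, pushWord, pushWord, h₂, stab_comp],
        by rw [pullWord, pullWord, pullWord, h₃, stab_comp]⟩
    | @merge m _ w' =>
      obtain ⟨w'', h₁, h₂, h₃⟩ := ih w'
      cases n with
      | zero => cases w
      | succ n =>
        -- The only case needing reordering: keeping and then merging equals merging first, by the
        -- square of `isPushout_mergeLast_keepLast` and its two images.
        refine ⟨.merge w'', ?_, ?_, ?_⟩
        · simp only [Word.toHom]
          rw [h₁, ← Category.assoc, ← Category.assoc, (isPushout_mergeLast_keepLast _).w]
        · simp only [pushWord]
          rw [h₂, ← Bicategory.Strict.assoc, ← Bicategory.Strict.assoc,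
            stab_pushWord_comp_mulLast]
        · simp only [pullWord]
          rw [h₃, Bicategory.Strict.assoc, Bicategory.Strict.assoc,
            comulLast_comp_stab_pullWord]

/-- The Beck-Chevalley property of pushout squares. -/
theorem exists_word_isPushout {n m : ℕ} (w : Word n m) : ∀ {m' : ℕ} (w' : Word n m'),
    ∃ (p : ℕ) (a : Word m p) (b : Word m' p), IsPushout w.toHom w'.toHom a.toHom b.toHom ∧
      A.pullWord w ≫ A.pushWord w' = A.pushWord a ≫ A.pullWord b := by
  induction w with
  | nil =>
    intro m' w'
    cases w'
    exact ⟨0, .nil, .nil, IsPushout.of_id_fst, rfl⟩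
  | @keep n m w ih =>
    intro m' w'
    cases w' with
    | keep w' =>
      obtain ⟨p, a, b, h, e⟩ := ih w'
      refine ⟨p + 1, .keep a, .keep b, isPushout_sumMap h IsPushout.of_id_fst, ?_⟩
      simp only [pushWord, pullWord]
      rw [← stab_comp, e, stab_comp]
    | @merge n _ w' =>
      obtain ⟨p, a, b, h, e⟩ := ih w'
      cases m with
      | zero => exact w.not_succ_zero.elim
      | succ m =>
        -- The elementary square is pasted to the pushout given by induction; its Beck-Chevalley
        -- equation is the Frobenius law.
        refine ⟨p, .merge a, b, (isPushout_mergeLast_keepLast w.toHom).flip.paste_vert h, ?_⟩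
        simp only [pushWord, pullWord]
        rw [← Bicategory.Strict.assoc, stab_pullWord_comp_mulLast, Bicategory.Strict.assoc, e,
          Bicategory.Strict.assoc]
  | @merge n m w ih =>
    intro m' w'
    cases w' with
    | @keep _ m' w' =>
      obtain ⟨p, a, b, h, e⟩ := ih w'
      cases m' with
      | zero => exact w'.not_succ_zero.elim
      | succ m' =>
        refine ⟨p, a, .merge b, (isPushout_mergeLast_keepLast w'.toHom).paste_horiz h, ?_⟩
        simp only [pushWord, pullWord]
        rw [Bicategory.Strict.assoc, comulLast_comp_stab_pushWord, ← Bicategory.Strict.assoc, e,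
          Bicategory.Strict.assoc]
    | merge w' =>
      obtain ⟨p, a, b, h, e⟩ := ih w'
      refine ⟨p, a, b, ?_, ?_⟩
      -- Precomposing both maps of a span with the epimorphism `mergeLast` does not change its
      -- pushout. On the algebra side the common letter cancels by separability.
      · refine ⟨⟨?_⟩, ⟨Limits.PushoutCocone.IsColimit.mk _ (fun s => h.desc s.inl s.inr ?_)
          (fun s => ?_) (fun s => ?_) (fun s t h₁ h₂ => ?_)⟩⟩
        · simp only [Word.toHom]
          rw [Category.assoc, h.w, Category.assoc]
        · have := s.condition
          simp only [Word.toHom] at this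
          rwa [Category.assoc, Category.assoc, cancel_epi] at this
        · exact h.inl_desc _ _ _
        · exact h.inr_desc _ _ _
        · exact h.hom_ext (by rw [h₁, h.inl_desc]) (by rw [h₂, h.inr_desc])
      · simp only [pushWord, pullWord]
        rw [Bicategory.Strict.assoc, ← Bicategory.Strict.assoc (A.comulLast n),
          comulLast_comp_mulLast, Bicategory.Strict.id_comp, e]

/-! ### Compatibility of powers and words with ordinal sum. -/

theorem power_add (n m : ℕ) : A.power (n + m) = tensorObj (A.power n) (A.power m) := by
  induction m with
  | zero => exact (tensor_unit_obj _).symm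
  | succ m ih => exact (congrArg (tensorObj · A.carrier) ih).trans (assoc_obj _ _ _)

theorem mulLast_add_heq (n m : ℕ) :
    HEq (A.mulLast (n + m)) (tensorHom (𝟙 (A.power n)) (A.mulLast m)) := by
  refine (A.mulLast_heq _).trans (.trans ?_ (tensorHom_heq rfl rfl (A.power_add_two m).symm rfl .rfl
    (A.mulLast_heq m).symm))
  refine .trans ?_ (assoc_map (𝟙 (A.power n)) (𝟙 (A.power m)) A.mul)
  refine tensorHom_heq (A.power_add n m) (A.power_add n m) rfl rfl ?_ .rfl
  exact (Bicategory.id_heq (A.power_add n m)).trans (heq_of_eq (tensorHom_id _ _).symm)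

theorem comulLast_add_heq (n m : ℕ) :
    HEq (A.comulLast (n + m)) (tensorHom (𝟙 (A.power n)) (A.comulLast m)) := by
  refine (A.comulLast_heq _).trans (.trans ?_ (tensorHom_heq rfl rfl rfl (A.power_add_two m).symm
    .rfl (A.comulLast_heq m).symm))
  refine .trans ?_ (assoc_map (𝟙 (A.power n)) (𝟙 (A.power m)) A.comul)
  refine tensorHom_heq (A.power_add n m) (A.power_add n m) rfl rfl ?_ .rfl
  exact (Bicategory.id_heq (A.power_add n m)).trans (heq_of_eq (tensorHom_id _ _).symm)

/-- Letters act at the right end, so the word of a sum consists of the letters of `w'` placed on top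
of `w`; hence the induction on `w'`. -/
theorem exists_word_sum {n n' : ℕ} (w : Word n n') {m m' : ℕ} (w' : Word m m') :
    ∃ w'' : Word (n + m) (n' + m'), w''.toHom = sumMap w.toHom w'.toHom ∧
      HEq (A.pushWord w'') (tensorHom (A.pushWord w) (A.pushWord w')) ∧
      HEq (A.pullWord w'') (tensorHom (A.pullWord w) (A.pullWord w')) := by
  induction w' with
  | nil => exact ⟨w, (eq_of_heq (sumMap_id_zero _)).symm, (tensor_unit_map _).symm,
      (tensor_unit_map _).symm⟩
  | @keep m m' w' ih =>
    obtain ⟨w'', h₁, h₂, h₃⟩ := ih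
    refine ⟨.keep w'', ?_, ?_, ?_⟩
    · rw [Word.toHom, h₁]
      exact eq_of_heq (sumMap_assoc _ _ _)
    · exact (tensorHom_heq (A.power_add _ _) (A.power_add _ _) rfl rfl h₂ .rfl).trans
        (assoc_map _ _ _)
    · exact (tensorHom_heq (A.power_add _ _) (A.power_add _ _) rfl rfl h₃ .rfl).trans
        (assoc_map _ _ _)
  | @merge m m' w' ih =>
    obtain ⟨w'', h₁, h₂, h₃⟩ := ih
    refine ⟨.merge (n := n + m) w'', ?_, ?_, ?_⟩
    · rw [Word.toHom, h₁, Word.toHom]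
      have e : mergeLast (n + m) = sumMap (𝟙 (SLin.mk n)) (mergeLast m) := by
        refine Eq.trans ?_ (eq_of_heq (sumMap_assoc (𝟙 (SLin.mk n)) (𝟙 (SLin.mk m)) nabla))
        rw [sumMap_id]
        rfl
      have := sumMap_comp (𝟙 (SLin.mk n)) (mergeLast m) w.toHom w'.toHom
      rw [Category.id_comp] at this
      rw [this, ← e]
      rfl
    · refine (Bicategory.comp_heq (A.power_add n (m + 2)) (A.power_add n (m + 1))
        (A.power_add n' m') (A.mulLast_add_heq n m) h₂).trans (heq_of_eq ?_)
      rw [← tensorHom_comp, Bicategory.Strict.id_comp]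
      rfl
    · refine (Bicategory.comp_heq (A.power_add n' m') (A.power_add n (m + 1))
        (A.power_add n (m + 2)) h₃ (A.comulLast_add_heq n m)).trans (heq_of_eq ?_)
      rw [← tensorHom_comp, Bicategory.Strict.comp_id]
      rfl

end ComoAlgebra

/-! ### Extensionality of 2-functors and preservation of units. -/

theorem CategoryTheory.StrictPseudofunctor.ext_heq {B : Type u} [Bicategory.{w, v} B]
    {C : Type u'} [Bicategory.{w', v'} C] {F G : StrictPseudofunctor B C}
    (hobj : ∀ X, F.obj X = G.obj X)
    (hmap : ∀ {X Y : B} (f : X ⟶ Y), HEq (F.map f) (G.map f))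
    (hmap₂ : ∀ {X Y : B} {f g : X ⟶ Y} (α : f ⟶ g), HEq (F.map₂ α) (G.map₂ α)) : F = G := by
  rcases F with ⟨⟨⟨⟨⟨⟨obj, map⟩, map₂⟩, _, _⟩, mapId, mapComp, _, _, _, _, _⟩, _, mapId_eq⟩, _,
    mapComp_eq⟩
  rcases G with ⟨⟨⟨⟨⟨⟨obj', map'⟩, map₂'⟩, _, _⟩, mapId', mapComp', _, _, _, _, _⟩, _, mapId_eq'⟩, _,
    mapComp_eq'⟩
  dsimp only at hobj hmap hmap₂ mapId_eq mapId_eq' mapComp_eq mapComp_eq'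
  obtain rfl : obj = obj' := funext hobj
  obtain rfl : @map = @map' := by
    funext X Y f
    exact eq_of_heq (hmap f)
  obtain rfl : @map₂ = @map₂' := by
    funext X Y f g α
    exact eq_of_heq (hmap₂ α)
  -- Strictness forces the comparison isomorphisms to be `eqToIso`s, so they carry no further data.
  obtain rfl : mapId = mapId' := funext fun X => (mapId_eq X).trans (mapId_eq' X).symm
  obtain rfl : @mapComp = @mapComp' := by
    funext X Y Z f g
    exact (mapComp_eq f g).trans (mapComp_eq' f g).symm
  rfl

theorem StrictMonoidalTwoFunctor.ext_heq {B : Type u} [Bicategory.{w, v} B] [Bicategory.Strict B]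
    [StrictMonoidalTwoCategory B] {C : Type u'} [Bicategory.{w', v'} C] [Bicategory.Strict C]
    [StrictMonoidalTwoCategory C] {F G : StrictMonoidalTwoFunctor B C}
    (hobj : ∀ X, F.obj X = G.obj X)
    (hmap : ∀ {X Y : B} (f : X ⟶ Y), HEq (F.map f) (G.map f))
    (hmap₂ : ∀ {X Y : B} {f g : X ⟶ Y} (α : f ⟶ g), HEq (F.map₂ α) (G.map₂ α)) : F = G := by
  have h := StrictPseudofunctor.ext_heq hobj hmap hmap₂
  cases F
  cases G
  dsimp only at h
  subst h
  rfl

/-- The unit of a Como-algebra is preserved as soon as its other data are. -/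
theorem StrictMonoidalTwoFunctor.map₂_unit_heq {B : Type u} [Bicategory.{w, v} B]
    [Bicategory.Strict B] [StrictMonoidalTwoCategory B] {C : Type u'} [Bicategory.{w', v'} C]
    [Bicategory.Strict C] [StrictMonoidalTwoCategory C] (F : StrictMonoidalTwoFunctor B C)
    (A : ComoAlgebra B) (A' : ComoAlgebra C) (h : F.obj A.carrier = A'.carrier)
    (hmul : HEq (F.map A.mul) A'.mul) (hcomul : HEq (F.map A.comul) A'.comul) :
    HEq (F.map₂ A.unit) A'.unit := by
  have h₂ : F.obj (tensorObj A.carrier A.carrier) = tensorObj A'.carrier A'.carrier :=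
    (F.obj_tensor _ _).trans (congrArg₂ tensorObj h h)
  -- By condition 4 both units become identities when whiskered with the comultiplication, and the
  -- adjunction leaves room for only one such cell.
  exact (A.reflAdj.map F.toStrictPseudofunctor).heq_of_isIdCell h₂ h h₂ hcomul
    ((heq_of_eq (F.map_id _)).trans (Bicategory.id_heq h₂))
    ((heq_of_eq (F.map_comp _ _)).trans (Bicategory.comp_heq h₂ h h₂ hmul hcomul)) (F.map_comp _ _)
    (F.isIdCell_whiskerLeft _ ⟨_, A.comul_unit⟩) ⟨_, A'.comul_unit⟩

/-! ## Existence of the classifying 2-functor -/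

namespace ComoAlgebra

open SLin
open scoped Bicategory

variable {B : Type u} [Bicategory.{w, v} B] [Bicategory.Strict B] [StrictMonoidalTwoCategory B]
  (A : ComoAlgebra B)

/-- The covariant action of a map of `sLin` on the powers of a Como-algebra. -/
noncomputable def push {X Y : SLin} (f : X ⟶ Y) : A.power X.card ⟶ A.power Y.card :=
  A.pushWord (Word.ofHom (n := X.card) (m := Y.card) f)

/-- The contravariant action of a map of `sLin` on the powers of a Como-algebra. -/
noncomputable def pull {X Y : SLin} (f : X ⟶ Y) : A.power Y.card ⟶ A.power X.card :=
  A.pullWord (Word.ofHom (n := X.card) (m := Y.card) f)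

theorem push_toHom {n m : ℕ} (w : Word n m) : A.push w.toHom = A.pushWord w :=
  congrArg A.pushWord (Word.ofHom_toHom w)

theorem pull_toHom {n m : ℕ} (w : Word n m) : A.pull w.toHom = A.pullWord w :=
  congrArg A.pullWord (Word.ofHom_toHom w)

theorem reflAdj_push_pull {X Y : SLin} (f : X ⟶ Y) : ReflAdj (A.push f) (A.pull f) :=
  A.reflAdj_word _

theorem push_comp_and_pull_comp {X Y Z : SLin} (f : X ⟶ Y) (g : Y ⟶ Z) :
    A.push (f ≫ g) = A.push f ≫ A.push g ∧ A.pull (f ≫ g) = A.pull g ≫ A.pull f := by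
  obtain ⟨n⟩ := X
  obtain ⟨m⟩ := Y
  obtain ⟨p⟩ := Z
  obtain ⟨w, rfl⟩ := Word.exists_toHom_eq f
  obtain ⟨w', rfl⟩ := Word.exists_toHom_eq g
  obtain ⟨w'', h, h₁, h₂⟩ := A.exists_word_comp w w'
  rw [← h]
  simp only [push_toHom, pull_toHom]
  exact ⟨h₁, h₂⟩

theorem push_comp {X Y Z : SLin} (f : X ⟶ Y) (g : Y ⟶ Z) :
    A.push (f ≫ g) = A.push f ≫ A.push g := (A.push_comp_and_pull_comp f g).1

theorem pull_comp {X Y Z : SLin} (f : X ⟶ Y) (g : Y ⟶ Z) :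
    A.pull (f ≫ g) = A.pull g ≫ A.pull f := (A.push_comp_and_pull_comp f g).2

theorem push_id_and_pull_id (X : SLin) : A.push (𝟙 X) = 𝟙 (A.power X.card) ∧
    A.pull (𝟙 X) = 𝟙 (A.power X.card) := by
  obtain ⟨n⟩ := X
  induction n with
  | zero =>
    have h : 𝟙 (SLin.mk 0) = Word.nil.toHom := rfl
    rw [h, push_toHom, pull_toHom]
    exact ⟨rfl, rfl⟩
  | succ n ih =>
    obtain ⟨w, hw⟩ := Word.exists_toHom_eq (𝟙 (SLin.mk n))
    have h : 𝟙 (SLin.mk (n + 1)) = w.keep.toHom := by rw [Word.toHom, hw, keepLast_id]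
    rw [← hw, push_toHom, pull_toHom] at ih
    rw [h, push_toHom, pull_toHom, pushWord, pullWord, ih.1, ih.2]
    exact ⟨stab_id _ _, stab_id _ _⟩

theorem push_id (X : SLin) : A.push (𝟙 X) = 𝟙 (A.power X.card) := (A.push_id_and_pull_id X).1

theorem pull_id (X : SLin) : A.pull (𝟙 X) = 𝟙 (A.power X.card) := (A.push_id_and_pull_id X).2

theorem push_sumMap_and_pull_sumMap {X Y X' Y' : SLin} (f : X ⟶ X') (g : Y ⟶ Y') :
    HEq (A.push (sumMap f g)) (tensorHom (A.push f) (A.push g)) ∧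
      HEq (A.pull (sumMap f g)) (tensorHom (A.pull f) (A.pull g)) := by
  obtain ⟨w, rfl⟩ := Word.exists_toHom_eq f
  obtain ⟨w', rfl⟩ := Word.exists_toHom_eq g
  obtain ⟨w'', h, h₁, h₂⟩ := A.exists_word_sum w w'
  rw [← h]
  have e := A.push_toHom w
  have e' := A.push_toHom w'
  have e'' := A.push_toHom w''
  have d := A.pull_toHom w
  have d' := A.pull_toHom w'
  have d'' := A.pull_toHom w''
  exact ⟨(heq_of_eq e'').trans (h₁.trans (heq_of_eq (congrArg₂ tensorHom e e').symm)),
    (heq_of_eq d'').trans (h₂.trans (heq_of_eq (congrArg₂ tensorHom d d').symm))⟩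

theorem pull_comp_push {X Y Z P : SLin} {f : X ⟶ Y} {g : X ⟶ Z} {a : Y ⟶ P} {b : Z ⟶ P}
    (h : IsPushout f g a b) : A.pull f ≫ A.push g = A.push a ≫ A.pull b := by
  obtain ⟨w, rfl⟩ := Word.exists_toHom_eq f
  obtain ⟨w', rfl⟩ := Word.exists_toHom_eq g
  obtain ⟨p, c, d, h', e⟩ := A.exists_word_isPushout w w'
  -- Pushouts are strictly unique, so the given square is the one constructed from the words.
  cases pushout_unique h h'
  exact (congrArg₂ _ (A.pull_toHom w) (A.push_toHom w')).trans
    (e.trans (congrArg₂ _ (A.push_toHom c) (A.pull_toHom d)).symm)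

/-! ### Images of cospans and of their 2-cells. -/

theorem pull_comp_self_push {X Y Z : SLin} (f : X ⟶ Y) (k : A.power Y.card ⟶ A.power Z.card) :
    A.pull f ≫ A.push f ≫ k = k := by
  rw [← Bicategory.Strict.assoc, (A.reflAdj_push_pull f).counit, Bicategory.Strict.id_comp]

/-- The image of a cospan. -/
noncomputable def cospanMap {X Y : CospanSLin} (f : X ⟶ Y) :
    A.power X.ord.card ⟶ A.power Y.ord.card :=
  A.push f.inl ≫ A.pull f.inr

theorem cospanMap_id (X : CospanSLin) : A.cospanMap (𝟙 X) = 𝟙 (A.power X.ord.card) := by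
  change A.push (𝟙 X.ord) ≫ A.pull (𝟙 X.ord) = _
  rw [push_id, pull_id, Bicategory.Strict.comp_id]

theorem cospanMap_comp {X Y Z : CospanSLin} (f : X ⟶ Y) (g : Y ⟶ Z) :
    A.cospanMap (f ≫ g) = A.cospanMap f ≫ A.cospanMap g := by
  change A.push (f.inl ≫ pushoutInl f.inr g.inl) ≫ A.pull (g.inr ≫ pushoutInr f.inr g.inl) = _
  rw [push_comp, pull_comp, cospanMap, cospanMap, Bicategory.Strict.assoc, Bicategory.Strict.assoc,
    ← Bicategory.Strict.assoc (A.push (pushoutInl _ _)), ← A.pull_comp_push (SLin.isPushout _ _),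
    Bicategory.Strict.assoc]

/-- The 2-cells that correspond to 2-cells of `Cospan(sLin)`. -/
def IsCospanCell {X Y : CospanSLin} {f g : X ⟶ Y} (θ : A.cospanMap f ⟶ A.cospanMap g) : Prop :=
  IsIdCell (A.pull g.inl ◁ θ)

/-- The target starts with `push g.inl`, whose right adjoint is the whiskering 1-cell. This
replaces, in the target 2-category, the fact that Cospan(sLin) has at most one 2-cell between two
cospans. -/
theorem IsCospanCell.eq {X Y : CospanSLin} {f g : X ⟶ Y} {θ θ' : A.cospanMap f ⟶ A.cospanMap g}
    (h : A.IsCospanCell θ) (h' : A.IsCospanCell θ') : θ = θ' :=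
  (A.reflAdj_push_pull g.inl).eq_of_isIdCell rfl h h'

/-- The legs of `g` are those of `f` followed by a map `a`, so the unit of the adjunction of `a`,
inserted between `push f.inl` and `pull f.inr`, has the right boundary. -/
theorem exists_isCospanCell {X Y : CospanSLin} {f g : X ⟶ Y} (α : f ⟶ g) :
    ∃ θ : A.cospanMap f ⟶ A.cospanMap g, A.IsCospanCell θ := by
  obtain ⟨P, l, r⟩ := g
  obtain ⟨a, hl, hr⟩ := α
  change f.apex ⟶ P at a
  change f.inl ≫ a = l at hl
  change f.inr ≫ a = r at hr
  subst hl hr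
  obtain ⟨-, η, -, h⟩ := A.reflAdj_push_pull a
  refine ⟨eqToHom (by rw [Bicategory.Strict.id_comp]; rfl) ≫ A.push f.inl ◁ η ▷ A.pull f.inr ≫
    eqToHom ?_, ?_⟩
  · change _ = A.push (f.inl ≫ a) ≫ A.pull (f.inr ≫ a)
    rw [push_comp, pull_comp]
    simp only [Bicategory.Strict.assoc]
  · change IsIdCell (A.pull (f.inl ≫ a) ◁ _)
    rw [pull_comp, Bicategory.whiskerLeft_comp, Bicategory.whiskerLeft_comp]
    refine .comp ((IsIdCell.of_eq _).whiskerLeft _) (.comp ?_ ((IsIdCell.of_eq _).whiskerLeft _))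
    -- The counit for `f.inl` cancels `pull f.inl ≫ push f.inl`; what remains is `pull a ◁ η`, an
    -- identity.
    rw [← IsIdCell.comp_whiskerLeft, IsIdCell.congr_whiskerLeft (k' := A.pull a),
      ← IsIdCell.whisker_assoc]
    · exact h.whiskerRight _
    · rw [Bicategory.Strict.assoc, (A.reflAdj_push_pull f.inl).counit, Bicategory.Strict.comp_id]

/-- The image of a 2-cell of `Cospan(sLin)`. -/
noncomputable def cospanMap₂ {X Y : CospanSLin} {f g : X ⟶ Y} (α : f ⟶ g) :
    A.cospanMap f ⟶ A.cospanMap g :=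
  (A.exists_isCospanCell α).choose

theorem isCospanCell_cospanMap₂ {X Y : CospanSLin} {f g : X ⟶ Y} (α : f ⟶ g) :
    A.IsCospanCell (A.cospanMap₂ α) :=
  (A.exists_isCospanCell α).choose_spec

theorem IsCospanCell.comp {X Y : CospanSLin} {f g h : X ⟶ Y} (β : g ⟶ h)
    {θ : A.cospanMap f ⟶ A.cospanMap g} {θ' : A.cospanMap g ⟶ A.cospanMap h}
    (H : A.IsCospanCell θ) (H' : A.IsCospanCell θ') : A.IsCospanCell (θ ≫ θ') := by
  unfold IsCospanCell
  rw [Bicategory.whiskerLeft_comp]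
  refine .comp ?_ H'
  -- The condition on `θ` concerns `pull g.inl`; since `h.inl` is `g.inl` followed by `β.hom`, `pull
  -- h.inl` factors through it.
  rw [IsIdCell.congr_whiskerLeft (k' := A.pull β.hom ≫ A.pull g.inl), IsIdCell.comp_whiskerLeft]
  · exact IsIdCell.whiskerLeft _ H
  · rw [← pull_comp, β.inl_hom]

theorem IsCospanCell.whiskerLeft {X Y Z : CospanSLin} (f : X ⟶ Y) {g g' : Y ⟶ Z}
    {θ : A.cospanMap g ⟶ A.cospanMap g'} (H : A.IsCospanCell θ) :
    A.IsCospanCell (eqToHom (A.cospanMap_comp f g) ≫ A.cospanMap f ◁ θ ≫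
      eqToHom (A.cospanMap_comp f g').symm) := by
  unfold IsCospanCell
  rw [Bicategory.whiskerLeft_comp, Bicategory.whiskerLeft_comp]
  refine .comp ((IsIdCell.of_eq _).whiskerLeft _) (.comp ?_ ((IsIdCell.of_eq _).whiskerLeft _))
  rw [← IsIdCell.comp_whiskerLeft, IsIdCell.congr_whiskerLeft
    (k' := A.pull (pushoutInr f.inr g'.inl) ≫ A.pull g'.inl), IsIdCell.comp_whiskerLeft]
  · exact IsIdCell.whiskerLeft _ H
  -- After cancelling `f.inl`, commutativity of the pushout square exchanges the route through
  -- `f.inr` for the one through `g'.inl`, where the hypothesis on `θ` applies.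
  · change A.pull (f.inl ≫ pushoutInl f.inr g'.inl) ≫ A.push f.inl ≫ A.pull f.inr = _
    rw [pull_comp, Bicategory.Strict.assoc, pull_comp_self_push, ← pull_comp, ← pull_comp,
      (SLin.isPushout f.inr g'.inl).w]

theorem IsCospanCell.whiskerRight {X Y Z : CospanSLin} {f f' : X ⟶ Y}
    {θ : A.cospanMap f ⟶ A.cospanMap f'} (H : A.IsCospanCell θ) (g : Y ⟶ Z) :
    A.IsCospanCell (eqToHom (A.cospanMap_comp f g) ≫ θ ▷ A.cospanMap g ≫
      eqToHom (A.cospanMap_comp f' g).symm) := by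
  unfold IsCospanCell
  rw [Bicategory.whiskerLeft_comp, Bicategory.whiskerLeft_comp]
  refine .comp ((IsIdCell.of_eq _).whiskerLeft _) (.comp ?_ ((IsIdCell.of_eq _).whiskerLeft _))
  rw [IsIdCell.congr_whiskerLeft (k' := A.pull (pushoutInl f'.inr g.inl) ≫ A.pull f'.inl),
    IsIdCell.comp_whiskerLeft]
  · refine .whiskerLeft _ ?_
    rw [← IsIdCell.whisker_assoc]
    exact IsIdCell.whiskerRight H _
  · change A.pull (f'.inl ≫ pushoutInl f'.inr g.inl) = _
    rw [pull_comp]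

/-- The underlying 2-functor of the strict monoidal 2-functor classifying a Como-algebra. -/
noncomputable def classifyingFunctor : StrictPseudofunctor CospanSLin B :=
  StrictPseudofunctor.mk''
    { obj X := A.power X.ord.card
      map f := A.cospanMap f
      map₂ α := A.cospanMap₂ α
      -- Each law for 2-cells holds because both sides are cospan cells with the same boundary.
      map₂_id _ := (A.isCospanCell_cospanMap₂ _).eq _ ((IsIdCell.id _).whiskerLeft _)
      map₂_comp _ β := (A.isCospanCell_cospanMap₂ _).eq _
        (.comp _ β (A.isCospanCell_cospanMap₂ _) (A.isCospanCell_cospanMap₂ _))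
      map_id X := A.cospanMap_id X
      map_comp f g := A.cospanMap_comp f g
      map₂_whisker_left f _ _ _ := (A.isCospanCell_cospanMap₂ _).eq _
        (.whiskerLeft _ f (A.isCospanCell_cospanMap₂ _))
      map₂_whisker_right _ g := (A.isCospanCell_cospanMap₂ _).eq _
        (.whiskerRight _ (A.isCospanCell_cospanMap₂ _) g) }

theorem cospanMap_sumHom {X Y X' Y' : CospanSLin} (f : X ⟶ X') (g : Y ⟶ Y') :
    HEq (A.cospanMap (CospanSLin.sumHom f g)) (tensorHom (A.cospanMap f) (A.cospanMap g)) := by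
  refine (Bicategory.comp_heq (A.power_add _ _) (A.power_add _ _) (A.power_add _ _)
    (A.push_sumMap_and_pull_sumMap f.inl g.inl).1
    (A.push_sumMap_and_pull_sumMap f.inr g.inr).2).trans (heq_of_eq ?_)
  exact (tensorHom_comp _ _ _ _).symm

theorem cospanMap₂_sumHom₂ {X Y X' Y' : CospanSLin} {f f' : X ⟶ X'} {g g' : Y ⟶ Y'} (α : f ⟶ f')
    (β : g ⟶ g') : HEq (A.cospanMap₂ (CospanSLin.sumHom₂ α β))
      (tensorHom₂ (A.cospanMap₂ α) (A.cospanMap₂ β)) :=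
  (A.reflAdj_push_pull (CospanSLin.sumHom f' g').inl).heq_of_isIdCell (A.power_add _ _)
    (A.power_add _ _) (A.power_add _ _) (A.push_sumMap_and_pull_sumMap f'.inl g'.inl).2
    (A.cospanMap_sumHom f g) (A.cospanMap_sumHom f' g') rfl (A.isCospanCell_cospanMap₂ _)
    (IsIdCell.tensor (A.isCospanCell_cospanMap₂ α) (A.isCospanCell_cospanMap₂ β))

/-- The strict monoidal 2-functor classifying a Como-algebra. -/
noncomputable def classifying : StrictMonoidalTwoFunctor CospanSLin B where
  toStrictPseudofunctor := A.classifyingFunctor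
  obj_unit := rfl
  obj_tensor X Y := A.power_add X.ord.card Y.ord.card
  map_tensor f g := A.cospanMap_sumHom f g
  map₂_tensor α β := A.cospanMap₂_sumHom₂ α β

/-! ### Value of the classifying 2-functor on the Como-algebra `1`. -/

theorem power_one : A.power 1 = A.carrier := unit_tensor_obj _

theorem power_two : A.power 2 = tensorObj A.carrier A.carrier :=
  congrArg (tensorObj · A.carrier) A.power_one

theorem push_nabla_heq : HEq (A.push nabla) A.mul := by
  have h : nabla = (Word.merge (.keep .nil)).toHom := Subsingleton.elim _ _
  refine (heq_of_eq ((congrArg A.push h).trans (A.push_toHom _))).trans ?_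
  simp only [pushWord]
  rw [stab_id, Bicategory.Strict.comp_id]
  exact (A.mulLast_heq 0).trans (unit_tensor_map _)

theorem pull_nabla_heq : HEq (A.pull nabla) A.comul := by
  have h : nabla = (Word.merge (.keep .nil)).toHom := Subsingleton.elim _ _
  refine (heq_of_eq ((congrArg A.pull h).trans (A.pull_toHom _))).trans ?_
  simp only [pullWord]
  rw [stab_id, Bicategory.Strict.id_comp]
  exact (A.comulLast_heq 0).trans (unit_tensor_map _)

theorem classifying_map_forward {X Y : SLin} (f : X ⟶ Y) :
    A.classifying.map (CospanSLin.forward f) = A.push f := by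
  change A.push f ≫ A.pull (𝟙 Y) = _
  rw [pull_id, Bicategory.Strict.comp_id]

theorem classifying_map_backward {X Y : SLin} (f : X ⟶ Y) :
    A.classifying.map (CospanSLin.backward f) = A.pull f := by
  change A.push (𝟙 Y) ≫ A.pull f = _
  rw [push_id, Bicategory.Strict.id_comp]

theorem classifying_mapsTo : A.classifying.MapsTo CospanSLin.como A where
  carrier := A.power_one
  mul := (heq_of_eq (A.classifying_map_forward nabla)).trans A.push_nabla_heq
  comul := (heq_of_eq (A.classifying_map_backward nabla)).trans A.pull_nabla_heq
  unit := StrictMonoidalTwoFunctor.map₂_unit_heq A.classifying CospanSLin.como A A.power_one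
    ((heq_of_eq (A.classifying_map_forward nabla)).trans A.push_nabla_heq)
    ((heq_of_eq (A.classifying_map_backward nabla)).trans A.pull_nabla_heq)

end ComoAlgebra

/-! ## Uniqueness of the classifying 2-functor -/

namespace CospanSLin

open scoped Bicategory

/-- As 2-cells of Cospan(sLin) are unique, conditions on them reduce to equations between 1-cells.
-/
theorem isIdCell_of_eq {X Y : CospanSLin} {f g : X ⟶ Y} (h : f = g) (θ : f ⟶ g) : IsIdCell θ :=
  ⟨h, Subsingleton.elim _ _⟩

theorem backward_comp_forward_self {X Y : SLin} (f : X ⟶ Y) :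
    backward f ≫ forward f = 𝟙 (CospanSLin.mk Y) := by
  refine backward_comp_forward (a := 𝟙 Y) (b := 𝟙 Y) ?_
  exact SLin.isPushout_of_adjacent rfl fun i hi e => .inl (by simpa using e)

theorem reflAdj {X Y : SLin} (f : X ⟶ Y) : ReflAdj (forward f) (backward f) := by
  have h := backward_comp_forward_self f
  refine ⟨h, bar f, isIdCell_of_eq ?_ _, isIdCell_of_eq ?_ _⟩
  · rw [Bicategory.Strict.assoc, h, Bicategory.Strict.id_comp, Bicategory.Strict.comp_id]
  · rw [← Bicategory.Strict.assoc, h, Bicategory.Strict.id_comp, Bicategory.Strict.comp_id]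

theorem eq_forward_comp_backward {X Y : CospanSLin} (f : X ⟶ Y) :
    f = forward f.inl ≫ backward f.inr := (forward_comp_backward f.inl f.inr).symm

/-- The defining condition of cospan cells, holding for all 2-cells already in Cospan(sLin); any
2-functor carries it over to its target. -/
theorem isIdCell_whiskerLeft {X Y : CospanSLin} {f g : X ⟶ Y} (α : f ⟶ g) :
    IsIdCell (backward g.inl ◁ α) := by
  refine isIdCell_of_eq ?_ _
  have h₁ : backward g.inl = backward α.hom ≫ backward f.inl := by
    rw [backward_comp, α.inl_hom]
  have h₂ : backward g.inr = backward α.hom ≫ backward f.inr := by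
    rw [backward_comp, α.inr_hom]
  have key : ∀ k : X ⟶ Y, backward k.inl ≫ k = backward k.inr := by
    intro k
    have e := congrArg (backward k.inl ≫ ·) (eq_forward_comp_backward k)
    refine e.trans ?_
    rw [← Bicategory.Strict.assoc, backward_comp_forward_self, Bicategory.Strict.id_comp]
  rw [key, h₁, h₂, Bicategory.Strict.assoc, key]

end CospanSLin

namespace StrictMonoidalTwoFunctor

open SLin

variable {B : Type u} [Bicategory.{w, v} B] [Bicategory.Strict B] [StrictMonoidalTwoCategory B]
  {A : ComoAlgebra B} {F : StrictMonoidalTwoFunctor CospanSLin B}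

theorem MapsTo.obj_eq (H : F.MapsTo CospanSLin.como A) (n : ℕ) :
    F.obj ⟨⟨n⟩⟩ = A.power n := by
  induction n with
  | zero => exact F.obj_unit
  | succ n ih => exact (F.obj_tensor ⟨⟨n⟩⟩ ⟨⟨1⟩⟩).trans (congrArg₂ tensorObj ih H.carrier)

theorem map_id_heq (F : StrictMonoidalTwoFunctor CospanSLin B) (X : CospanSLin) {Y : B}
    (h : F.obj X = Y) : HEq (F.map (𝟙 X)) (𝟙 Y) :=
  (heq_of_eq (F.map_id X)).trans (Bicategory.id_heq h)

theorem MapsTo.map_tensor_id_heq (H : F.MapsTo CospanSLin.como A) {n m : ℕ}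
    (f : CospanSLin.mk ⟨n⟩ ⟶ CospanSLin.mk ⟨m⟩) {f' : A.power n ⟶ A.power m}
    (h : HEq (F.map f) f') :
    HEq (F.map (CospanSLin.sumHom f (𝟙 (CospanSLin.mk ⟨1⟩)))) (A.stab f') :=
  (F.map_tensor f (𝟙 (CospanSLin.mk ⟨1⟩))).trans (tensorHom_heq (H.obj_eq n) (H.obj_eq m) H.carrier
    H.carrier h (F.map_id_heq _ H.carrier))

/-- Each letter is an ordinal sum of identities and ∇, so preservation of sums and of ∇ determines
the value of `F` on it. -/
theorem MapsTo.map_forward_toHom (H : F.MapsTo CospanSLin.como A) {n m : ℕ} (w : Word n m) :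
    HEq (F.map (CospanSLin.forward w.toHom)) (A.pushWord w) := by
  induction w with
  | nil => exact F.map_id_heq _ (H.obj_eq 0)
  | keep w ih =>
    have e : CospanSLin.forward (keepLast w.toHom) = CospanSLin.sumHom (CospanSLin.forward w.toHom)
      (𝟙 (CospanSLin.mk ⟨1⟩)) := (CospanSLin.sumHom_forward w.toHom (𝟙 (SLin.mk 1))).symm
    rw [Word.toHom, e]
    exact H.map_tensor_id_heq _ ih
  | @merge n m w ih =>
    have h : HEq (F.map (CospanSLin.forward (mergeLast n))) (A.mulLast n) := by
      refine .trans ?_ (A.mulLast_heq n).symm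
      have e : CospanSLin.forward (mergeLast n) = CospanSLin.sumHom (𝟙 (CospanSLin.mk ⟨n⟩))
        (CospanSLin.forward nabla) := (CospanSLin.sumHom_forward (𝟙 (SLin.mk n)) nabla).symm
      rw [e]
      refine (F.map_tensor (𝟙 (CospanSLin.mk ⟨n⟩)) (CospanSLin.forward nabla)).trans
        (tensorHom_heq (H.obj_eq n) (H.obj_eq n) ?_ H.carrier (F.map_id_heq _ (H.obj_eq n)) H.mul)
      exact (H.obj_eq 2).trans A.power_two
    rw [Word.toHom, ← CospanSLin.forward_comp, F.map_comp]
    exact Bicategory.comp_heq (H.obj_eq _) (H.obj_eq _) (H.obj_eq _) h ih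

theorem MapsTo.map_backward_toHom (H : F.MapsTo CospanSLin.como A) {n m : ℕ} (w : Word n m) :
    HEq (F.map (CospanSLin.backward w.toHom)) (A.pullWord w) := by
  induction w with
  | nil => exact F.map_id_heq _ (H.obj_eq 0)
  | keep w ih =>
    have e : CospanSLin.backward (keepLast w.toHom) = CospanSLin.sumHom (CospanSLin.backward w.toHom)
      (𝟙 (CospanSLin.mk ⟨1⟩)) := (CospanSLin.sumHom_backward w.toHom (𝟙 (SLin.mk 1))).symm
    rw [Word.toHom, e]
    exact H.map_tensor_id_heq _ ih
  | @merge n m w ih =>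
    have h : HEq (F.map (CospanSLin.backward (mergeLast n))) (A.comulLast n) := by
      refine .trans ?_ (A.comulLast_heq n).symm
      have e : CospanSLin.backward (mergeLast n) = CospanSLin.sumHom (𝟙 (CospanSLin.mk ⟨n⟩))
        (CospanSLin.backward nabla) := (CospanSLin.sumHom_backward (𝟙 (SLin.mk n)) nabla).symm
      rw [e]
      refine (F.map_tensor (𝟙 (CospanSLin.mk ⟨n⟩)) (CospanSLin.backward nabla)).trans
        (tensorHom_heq (H.obj_eq n) (H.obj_eq n) H.carrier ?_ (F.map_id_heq _ (H.obj_eq n)) H.comul)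
      exact (H.obj_eq 2).trans A.power_two
    rw [Word.toHom, ← CospanSLin.backward_comp, F.map_comp]
    exact Bicategory.comp_heq (H.obj_eq _) (H.obj_eq _) (H.obj_eq _) ih h

theorem MapsTo.map_forward (H : F.MapsTo CospanSLin.como A) {X Y : SLin} (f : X ⟶ Y) :
    HEq (F.map (CospanSLin.forward f)) (A.push f) := by
  have := H.map_forward_toHom (Word.ofHom (n := X.card) (m := Y.card) f)
  rwa [Word.toHom_ofHom] at this

theorem MapsTo.map_backward (H : F.MapsTo CospanSLin.como A) {X Y : SLin} (f : X ⟶ Y) :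
    HEq (F.map (CospanSLin.backward f)) (A.pull f) := by
  have := H.map_backward_toHom (Word.ofHom (n := X.card) (m := Y.card) f)
  rwa [Word.toHom_ofHom] at this

theorem MapsTo.map_heq (H : F.MapsTo CospanSLin.como A) {X Y : CospanSLin} (f : X ⟶ Y) :
    HEq (F.map f) (A.cospanMap f) := by
  rw [CospanSLin.eq_forward_comp_backward f, F.map_comp, ← CospanSLin.eq_forward_comp_backward f]
  exact Bicategory.comp_heq (H.obj_eq _) (H.obj_eq _) (H.obj_eq _) (H.map_forward _)
    (H.map_backward _)

/-- Both cells become identities when whiskered with the right adjoint, so 2-cells need not be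
generated from η. -/
theorem MapsTo.map₂_heq (H : F.MapsTo CospanSLin.como A) {X Y : CospanSLin} {f g : X ⟶ Y}
    (α : f ⟶ g) : HEq (F.map₂ α) (A.cospanMap₂ α) :=
  ((CospanSLin.reflAdj g.inl).map F.toStrictPseudofunctor).heq_of_isIdCell (H.obj_eq _)
    (H.obj_eq _) (H.obj_eq _) (H.map_backward g.inl) (H.map_heq f) (H.map_heq g)
    ((congrArg F.map (CospanSLin.eq_forward_comp_backward g)).trans (F.map_comp _ _))
    (F.isIdCell_whiskerLeft _ (CospanSLin.isIdCell_whiskerLeft α)) (A.isCospanCell_cospanMap₂ α)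

end StrictMonoidalTwoFunctor

theorem mainTheorem1 {D : Type u} [Bicategory.{w, v} D] [Bicategory.Strict D]
    [StrictMonoidalTwoCategory D] (A : ComoAlgebra D) :
    ∃! F : StrictMonoidalTwoFunctor CospanSLin D, F.MapsTo CospanSLin.como A :=
  ⟨A.classifying, A.classifying_mapsTo, fun _ H => StrictMonoidalTwoFunctor.ext_heq
    (fun X => H.obj_eq X.ord.card) (fun f => H.map_heq f) (fun α => H.map₂_heq α)⟩
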